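/- Let $G$ be a finitely generated group, let $S$ be a finite generating set of $G$ and let $\ell$ be the associated word length. For $\xi:G\to\mathbb{C}$ and $\varphi:G\to\mathbb{C}$ write $(\xi*\varphi)(x)=\sum_{z\in G}\xi(z)\varphi(z^{-1}x)$. Let $C^*_r(G)$ be the operator norm closure of $\mathbb{C}G$ acting on $\ell^2(G)$ by left convolution. The group $G$ has the rapid decay property if $$\mathbf{H}^\infty_\ell(G)=\bigcap_{s\ge 0}\{\xi\in\ell^2(G) : \xi(1+\ell)^s\in\ell^2(G)\}$$ is contained in $C^*_r(G)$, i.e. for every $\xi\in \mathbf{H}^\infty_\ell(G)$ left convolution by $\xi$ is a bounded operator on $\ell^2(G)$ belonging to $C^*_r(G)$. For a subgroup $H<G$ let $\ell^{(2,1)}(G,H)$ be the Banach space of functions $f$ on $G$ with $$\|f\|_{(2,1)}=\Big(\sum_{gH\in G/H}\big(\sum_{x\in gH}|f(x)|\big)^2\Big)^{1/2}<\infty,$$ and let $B^*_r(G,H)$ be the operator norm closure of $\mathbb{C}G$ acting on $\ell^{(2,1)}(G,H)$ by left convolution. The pair $(G,H)$ has the rapid decay property if there is $s>0$ such that $$\mathbf{H}^s_\ell(G,H)=\{\xi\in\ell^2(G)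 : \xi(1+\ell)^s\in\ell^{(2,1)}(G,H)\}$$ is contained in $B^*_r(G,H)$, i.e. for every $\xi\in\mathbf{H}^s_\ell(G,H)$ left convolution by $\xi$ is a bounded operator on $\ell^{(2,1)}(G,H)$ belonging to $B^*_r(G,H)$. The subgroup $H$ has polynomial growth for the length induced by $G$ if there is a polynomial $Q$ with $|\{h\in H : \ell(h)\le R\}|\le Q(R)$ for all $R\ge 0$. The following are equivalent: 1. The group $G$ has the rapid decay property. 2. For every subgroup $H<G$ of polynomial growth for the length induced by $G$, the pair $(G,H)$ has the rapid decay property. 3. There exists a subgroup $H<G$ of polynomial growth for the length induced by $G$ such that the pair $(G,H)$ has the rapid decay property. -/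

import Mathlib

open scoped ENNReal

noncomputable section

/-- The word length of `x` with respect to `S`: the least `n` such that `x` is a product of `n`
elements of `S ∪ S⁻¹` (in particular the identity has length `0`). -/
def wordLength {G : Type*} [Group G] (S : Finset G) (x : G) : ℕ :=
  sInf {n : ℕ | ∃ l : List G, l.length = n ∧ (∀ s ∈ l, s ∈ S ∨ s⁻¹ ∈ S) ∧ l.prod = x}

/-- The convolution product `(f * φ)(x) = ∑ z, f(z) φ(z⁻¹ x)` of functions on a group.
It is only used below for `f, φ` square-summable, where the sum converges absolutely. -/
def convolution {G : Type*} [Group G] (f φ : G → ℂ) : G → ℂ :=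
  fun x => ∑' z : G, f z * φ (z⁻¹ * x)

/-- The Hilbert space `ℓ²(G)`. -/
abbrev EllTwo (G : Type*) := lp (fun _ : G => ℂ) 2

/-- The (carrier of the) reduced C*-algebra `C*_r(G)`: the operator norm closure, in the bounded
operators on `ℓ²(G)`, of the group algebra `ℂG` acting by left convolution. -/
def reducedCStar (G : Type*) [Group G] : Set (EllTwo G →L[ℂ] EllTwo G) :=
  closure {T | ∃ f : G →₀ ℂ, ∀ φ : EllTwo G, (T φ : G → ℂ) = convolution f φ}

/-- The space `H_ℓ^s(G)` of all `ξ ∈ ℓ²(G)` with `ξ (1 + ℓ)^s ∈ ℓ²(G)`. -/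
def sobolev {G : Type*} (ℓ : G → ℕ) (s : ℝ) : Set (G → ℂ) :=
  {ξ | Memℓp ξ 2 ∧ Memℓp (fun x => ξ x * (((1 + (ℓ x : ℝ)) ^ s : ℝ) : ℂ)) 2}

/-- The space `H_ℓ^∞(G)`, the intersection of all `H_ℓ^s(G)` with `s ≥ 0`. -/
def sobolevInfty {G : Type*} (ℓ : G → ℕ) : Set (G → ℂ) :=
  {ξ | ∀ s : ℝ, 0 ≤ s → ξ ∈ sobolev ℓ s}

/-- Rapid decay of the group `G` for the length `ℓ`: the space `H_ℓ^∞(G)` embeds in `C*_r(G)`,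
that is, for every `ξ` in it the left convolution by `ξ` is an operator belonging to `C*_r(G)`. -/
def RapidDecay {G : Type*} [Group G] (ℓ : G → ℕ) : Prop :=
  ∀ ξ ∈ sobolevInfty ℓ, ∃ T ∈ reducedCStar G,
    ∀ φ : EllTwo G, (T φ : G → ℂ) = convolution ξ φ

/-- The Banach space `ℓ^(2,1)(G, H)`, with the hybrid norm
`‖f‖ = (∑_{gH ∈ G/H} ‖f|_{gH}‖₁ ^ 2)^(1/2)`: an element is the family of its restrictions to the
left cosets of `H`, each being in `ℓ¹` of that coset, with square-summable `ℓ¹`-norms. -/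
abbrev HybridLp {G : Type*} [Group G] (H : Subgroup G) :=
  lp (fun q : G ⧸ H => lp (fun _ : {x : G // (x : G ⧸ H) = q} => ℂ) 1) 2

/-- An element of `ℓ^(2,1)(G, H)` as a function on `G`. -/
def hybridFun {G : Type*} [Group G] {H : Subgroup G} (φ : HybridLp H) : G → ℂ :=
  fun x => φ (x : G ⧸ H) ⟨x, rfl⟩

/-- The (carrier of the) Banach algebra `B*_r(G, H)`: the operator norm closure, in the bounded
operators on `ℓ^(2,1)(G, H)`, of the group algebra `ℂG` acting by left convolution. -/
def hybridAlgebra {G : Type*} [Group G] (H : Subgroup G) : Set (HybridLp H →L[ℂ] HybridLp H) :=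
  closure {T | ∃ f : G →₀ ℂ, ∀ φ : HybridLp H, hybridFun (T φ) = convolution f (hybridFun φ)}

/-- The hybrid Sobolev space `H_ℓ^s(G, H)` of all `ξ ∈ ℓ²(G)` with
`ξ (1 + ℓ)^s ∈ ℓ^(2,1)(G, H)`. -/
def hybridSobolev {G : Type*} [Group G] (ℓ : G → ℕ) (H : Subgroup G) (s : ℝ) : Set (G → ℂ) :=
  {ξ | Memℓp ξ 2 ∧
    ∃ η : HybridLp H, hybridFun η = fun x => ξ x * (((1 + (ℓ x : ℝ)) ^ s : ℝ) : ℂ)}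

/-- Rapid decay of the pair `(G, H)` for the length `ℓ`: for some `s > 0` the hybrid Sobolev space
`H_ℓ^s(G, H)` embeds in `B*_r(G, H)`, that is, for every `ξ` in it the left convolution by `ξ` is
an operator belonging to `B*_r(G, H)`. -/
def PairRapidDecay {G : Type*} [Group G] (ℓ : G → ℕ) (H : Subgroup G) : Prop :=
  ∃ s : ℝ, 0 < s ∧ ∀ ξ ∈ hybridSobolev ℓ H s, ∃ T ∈ hybridAlgebra H,
    ∀ φ : HybridLp H, hybridFun (T φ) = convolution ξ (hybridFun φ)

/-- The subgroup `H` has polynomial growth for the length induced by `ℓ`: the number of elements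
of `H` in the ball of radius `R` of `G` is bounded by a polynomial in `R`. -/
def PolynomialGrowth {G : Type*} [Group G] (ℓ : G → ℕ) (H : Subgroup G) : Prop :=
  ∃ Q : Polynomial ℝ, ∀ R : ℝ, 0 ≤ R →
    {h : G | h ∈ H ∧ (ℓ h : ℝ) ≤ R}.Finite ∧
      (({h : G | h ∈ H ∧ (ℓ h : ℝ) ≤ R}.ncard : ℕ) : ℝ) ≤ Q.eval R

end

/-! Both rapid decay properties reduce to inequalities for nonnegative functions. Convolution by a
complex function is dominated by convolution with its absolute value, and there is no cancellation
between nonnegative functions. Summing over left cosets turns left convolution on `G` into the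
action on `G ⧸ H`, so for `u ≥ 0` the norm of convolution on `ℓ^(2,1)(G, H)` is its norm on `ℓ²(G ⧸
H)`. A gliding hump argument (`exists_uniform_actBound`) upgrades rapid decay to a uniform bound of
the convolution norm by a weighted norm. Conversely, such a bound makes convolution the norm limit
of its finite truncations (`ConvolutionModel.exists_mem_closure`).

It remains to compare the norms of `u ≥ 0` on `ℓ²(G)` and `ℓ²(G ⧸ H)`. The regular norm is always at
most the quasi-regular one, by Minkowski's inequality on each coset (`ActBound.of_quotient`). If `H`
has polynomial growth and `u` is finitely supported, the reverse holds (`ActBound.to_quotient`).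
Apply `n` alternating factors `T`, `T*` to a finitely supported `v`: only a ball of radius linear in
`n` matters, and lifting `v` to that ball costs a polynomial factor. Log-convexity of the norms of
the iterates removes this factor.

For the weighted norms, the usual one is below the hybrid one, and Cauchy–Schwarz on cosets bounds
the hybrid one by a usual one of higher order when `H` has polynomial growth
(`l2_cosetSum_lengthWeight_le`). The trivial subgroup links the universal and existential
statements. -/

open scoped ENNReal

noncomputable section

/-- The `ℓ²` norm of a function with values in `[0, ∞]`. -/
def l2 {X : Type*} (u : X → ℝ≥0∞) : ℝ≥0∞ := (∑' x, u x ^ 2) ^ (1 / 2 : ℝ)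

theorem sqrt_sq (a : ℝ≥0∞) : (a ^ (1 / 2 : ℝ)) ^ 2 = a := by
  rw [← ENNReal.rpow_natCast, ← ENNReal.rpow_mul]; norm_num

theorem sq_sqrt (a : ℝ≥0∞) : (a ^ 2) ^ (1 / 2 : ℝ) = a := by
  rw [← ENNReal.rpow_natCast, ← ENNReal.rpow_mul]; norm_num

/-! ### Extended-real `ℓ²` norms: Cauchy–Schwarz, duality, Minkowski. -/

section l2

variable {X : Type*}

theorem l2_sq (u : X → ℝ≥0∞) : l2 u ^ 2 = ∑' x, u x ^ 2 := sqrt_sq _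

theorem l2_le_iff {u : X → ℝ≥0∞} {K : ℝ≥0∞} : l2 u ≤ K ↔ ∑' x, u x ^ 2 ≤ K ^ 2 := by
  rw [← l2_sq]
  exact (ENNReal.pow_le_pow_left_iff two_ne_zero).symm

theorem l2_mono {u v : X → ℝ≥0∞} (h : ∀ x, u x ≤ v x) : l2 u ≤ l2 v := by
  unfold l2
  gcongr with x
  exact h x

theorem le_l2 (u : X → ℝ≥0∞) (x : X) : u x ≤ l2 u := by
  rw [← ENNReal.pow_le_pow_left_iff two_ne_zero, l2_sq]
  exact ENNReal.le_tsum x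

theorem l2_const_mul (c : ℝ≥0∞) (u : X → ℝ≥0∞) : l2 (fun x => c * u x) = c * l2 u := by
  unfold l2
  simp_rw [mul_pow]
  rw [ENNReal.tsum_mul_left, ENNReal.mul_rpow_of_nonneg _ _ (by norm_num), sq_sqrt]

theorem tsum_mul_le_l2 (u v : X → ℝ≥0∞) : ∑' x, u x * v x ≤ l2 u * l2 v := by
  rw [ENNReal.tsum_eq_iSup_sum]
  refine iSup_le fun F => ?_
  refine (ENNReal.inner_le_Lp_mul_Lq F u v Real.HolderConjugate.two_two).trans ?_
  unfold l2
  simp only [ENNReal.rpow_two]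
  gcongr <;> exact ENNReal.sum_le_tsum F

theorem l2_eq_zero {u : X → ℝ≥0∞} : l2 u = 0 ↔ ∀ x, u x = 0 := by
  constructor
  · intro h x
    exact le_antisymm ((le_l2 u x).trans h.le) zero_le
  · intro h
    simp [l2, h]

theorem l2_indicator_singleton [DecidableEq X] (x : X) :
    l2 (fun y => if y = x then (1 : ℝ≥0∞) else 0) = 1 := by
  simp [l2]

/-- Functions are normed by their pairings. -/
theorem l2_le_of_forall_pairing_le {t : X → ℝ≥0∞} {K : ℝ≥0∞}
    (h : ∀ w : X → ℝ≥0∞, ∑' x, t x * w x ≤ K * l2 w) : l2 t ≤ K := by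
  classical
  rw [l2_le_iff, ENNReal.tsum_eq_iSup_sum]
  refine iSup_le fun F => ?_
  -- An infinite value is detected by pairing with a point mass, which forces `K = ∞`.
  by_cases htop : ∃ x, t x = ∞
  · obtain ⟨x, hx⟩ := htop
    have := h (fun y => if y = x then 1 else 0)
    simp only [mul_ite, mul_one, mul_zero, tsum_ite_eq, l2_indicator_singleton, hx] at this
    simp [top_le_iff.1 this]
  · push Not at htop
    set s := ∑ x ∈ F, t x ^ 2 with hs
    have hsum (n : ℕ) (hn : n ≠ 0) : ∑' x, (if x ∈ F then t x ^ n else 0) = ∑ x ∈ F, t x ^ n := by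
      rw [tsum_eq_sum (s := F) (fun x hx => by simp [hx])]
      exact Finset.sum_congr rfl fun x hx => by simp [hx]
    have h1 : ∑' x, t x * (if x ∈ F then t x else 0) = s := by
      rw [hs, ← hsum 2 two_ne_zero]
      exact tsum_congr fun x => by split_ifs <;> simp [sq]
    have h2 : l2 (fun x => if x ∈ F then t x else 0) = s ^ (1 / 2 : ℝ) := by
      rw [hs, ← hsum 2 two_ne_zero, l2]
      congr 1
      exact tsum_congr fun x => by split_ifs <;> simp
    -- Testing on `t` cut off to `F` gives `r ^ 2 ≤ K * r`, where `r` is the `ℓ²` norm of the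
    -- cut-off; then cancel `r`.
    have h3 := h (fun x => if x ∈ F then t x else 0)
    rw [h1, h2] at h3
    have hst : s ≠ ∞ := by
      rw [hs]
      exact (ENNReal.sum_lt_top.2 fun x _ => ENNReal.pow_lt_top (htop x).lt_top).ne
    set r := s ^ (1 / 2 : ℝ) with hr
    have hrs : r ^ 2 = s := sqrt_sq s
    rw [← hrs] at h3 ⊢
    rcases eq_or_ne r 0 with h0 | h0
    · simp [h0]
    · have hrt : r ≠ ∞ := by
        rintro h'
        rw [h'] at hrs
        exact hst (by rw [← hrs]; simp)
      rw [sq] at h3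
      gcongr
      exact (ENNReal.mul_le_mul_iff_left h0 hrt).1 h3

/-- Minkowski's inequality for infinite sums. -/
theorem l2_tsum_le {ι : Type*} (a : ι → X → ℝ≥0∞) :
    l2 (fun x => ∑' i, a i x) ≤ ∑' i, l2 (a i) := by
  refine l2_le_of_forall_pairing_le fun w => ?_
  simp_rw [← ENNReal.tsum_mul_right]
  rw [ENNReal.tsum_comm]
  exact ENNReal.tsum_le_tsum fun i => tsum_mul_le_l2 _ _

theorem l2_ne_top_of_finite_support {u : X → ℝ≥0∞} (F : Finset X) (hF : ∀ x ∉ F, u x = 0)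
    (hu : ∀ x, u x ≠ ∞) : l2 u ≠ ∞ := by
  unfold l2
  rw [tsum_eq_sum (s := F) (fun x hx => by simp [hF x hx])]
  refine ENNReal.rpow_ne_top_of_nonneg (by norm_num) ?_
  exact (ENNReal.sum_lt_top.2 fun x _ => ENNReal.pow_lt_top (hu x).lt_top).ne

end l2

/-! ### Convolution operators of nonnegative functions and their adjoints. -/

section actConv

variable {G X : Type*} [Group G] [MulAction G X]

/-- The action by convolution of functions on `G` on functions on a `G`-set. -/
def actConv (u : G → ℝ≥0∞) (v : X → ℝ≥0∞) : X → ℝ≥0∞ :=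
  fun x => ∑' z, u z * v (z⁻¹ • x)

/-- `K` bounds the norm of convolution by `u` on `ℓ²(X)`. -/
def ActBound (X : Type*) [MulAction G X] (u : G → ℝ≥0∞) (K : ℝ≥0∞) : Prop :=
  ∀ v : X → ℝ≥0∞, l2 (actConv u v) ≤ K * l2 v

theorem actConv_mono {u u' : G → ℝ≥0∞} {v v' : X → ℝ≥0∞} (hu : ∀ z, u z ≤ u' z)
    (hv : ∀ x, v x ≤ v' x) (x : X) : actConv u v x ≤ actConv u' v' x :=
  ENNReal.tsum_le_tsum fun z => mul_le_mul' (hu z) (hv _)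

theorem ActBound.mono {u u' : G → ℝ≥0∞} {K K' : ℝ≥0∞} (h : ActBound X u' K)
    (hu : ∀ z, u z ≤ u' z) (hK : K ≤ K') : ActBound X u K' := fun v =>
  (l2_mono (actConv_mono hu fun _ => le_rfl)).trans ((h v).trans (by gcongr))

theorem actConv_const_mul (c : ℝ≥0∞) (u : G → ℝ≥0∞) (v : X → ℝ≥0∞) :
    actConv (fun z => c * u z) v = fun x => c * actConv u v x := by
  funext x
  simp only [actConv, mul_assoc, ENNReal.tsum_mul_left]

theorem ActBound.const_mul {u : G → ℝ≥0∞} {K : ℝ≥0∞} (h : ActBound X u K) (c : ℝ≥0∞) :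
    ActBound X (fun z => c * u z) (c * K) := fun v => by
  rw [actConv_const_mul, l2_const_mul, mul_assoc]
  gcongr
  exact h v

theorem actBound_top (u : G → ℝ≥0∞) : ActBound X u ∞ := fun v => by
  by_cases hv : l2 v = 0
  · have : l2 (actConv u v) = 0 := l2_eq_zero.2 fun x => by
      simp [actConv, l2_eq_zero.1 hv]
    simp [this]
  · simp [ENNReal.top_mul hv]

theorem actBound_zero : ActBound X (fun _ : G => 0) 0 := fun v => by
  simp [actConv, l2]

theorem actConv_ne_zero {u : G → ℝ≥0∞} {v : X → ℝ≥0∞} {x : X} (h : actConv u v x ≠ 0) :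
    ∃ z, u z ≠ 0 ∧ v (z⁻¹ • x) ≠ 0 := by
  by_contra! hc
  refine h (ENNReal.tsum_eq_zero.2 fun z => ?_)
  by_cases hz : u z = 0
  · simp [hz]
  · simp [hc z hz]

/-- Convolution by `z ↦ u z⁻¹` is the adjoint of convolution by `u`. -/
theorem tsum_actConv_mul (u : G → ℝ≥0∞) (v w : X → ℝ≥0∞) :
    ∑' x, actConv u v x * w x = ∑' x, v x * actConv (fun z => u z⁻¹) w x := by
  simp only [actConv, ← ENNReal.tsum_mul_left, ← ENNReal.tsum_mul_right]
  rw [ENNReal.tsum_comm, ENNReal.tsum_comm (f := fun x z => v x * (u z⁻¹ * w (z⁻¹ • x)))]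
  rw [← (Equiv.inv G).tsum_eq]
  refine tsum_congr fun z => ?_
  rw [← (MulAction.toPerm (z⁻¹ : G)).tsum_eq]
  refine tsum_congr fun x => ?_
  simp only [Equiv.inv_apply, MulAction.toPerm_apply, inv_inv, smul_inv_smul]
  ring

theorem ActBound.adjoint {u : G → ℝ≥0∞} {K : ℝ≥0∞} (h : ActBound X u K) :
    ActBound X (fun z => u z⁻¹) K := fun v => by
  refine l2_le_of_forall_pairing_le fun w => ?_
  have h1 := tsum_actConv_mul u w v
  calc ∑' x, actConv (fun z => u z⁻¹) v x * w x = ∑' x, w x * actConv (fun z => u z⁻¹) v x := by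
        simp_rw [mul_comm]
    _ = ∑' x, actConv u w x * v x := h1.symm
    _ ≤ l2 (actConv u w) * l2 v := tsum_mul_le_l2 _ _
    _ ≤ K * l2 w * l2 v := by gcongr; exact h w
    _ = K * l2 v * l2 w := by ring

end actConv

/-! ### Reduction to finitely supported functions. -/

section truncation

open Filter Topology

/-- Lower semicontinuity: finite partial sums pass to the pointwise limit. -/
theorem l2_le_of_tendsto {X ι : Type*} {l : Filter ι} [l.NeBot] {t : ι → X → ℝ≥0∞}
    {t' : X → ℝ≥0∞} {K : ℝ≥0∞} (ht : ∀ x, Tendsto (fun i => t i x) l (𝓝 (t' x)))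
    (hK : ∀ i, l2 (t i) ≤ K) : l2 t' ≤ K := by
  rw [l2_le_iff, ENNReal.tsum_eq_iSup_sum]
  refine iSup_le fun F => ?_
  have : Tendsto (fun i => ∑ x ∈ F, t i x ^ 2) l (𝓝 (∑ x ∈ F, t' x ^ 2)) :=
    tendsto_finsetSum _ fun x _ => ENNReal.Tendsto.pow (ht x)
  exact le_of_tendsto' this fun i => (ENNReal.sum_le_tsum F).trans (l2_le_iff.1 (hK i))

variable {G X : Type*} [Group G] [MulAction G X]

theorem ActBound.of_truncations {u : G → ℝ≥0∞} {K : ℝ≥0∞}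
    (h : ∀ F : Finset G, ActBound X (Set.indicator (F : Set G) u) K) : ActBound X u K := by
  classical
  intro v
  refine l2_le_of_tendsto (l := atTop)
    (t := fun F : Finset G => actConv (Set.indicator (F : Set G) u) v) (fun x => ?_)
    fun F => h F v
  have h1 : HasSum (fun z => u z * v (z⁻¹ • x)) (actConv u v x) := ENNReal.summable.hasSum
  refine Tendsto.congr (fun F => ?_) h1
  rw [actConv, tsum_eq_sum (s := F) (fun z hz => by simp [hz])]
  exact Finset.sum_congr rfl fun z hz => by simp [hz]

theorem actConv_eq_sum {u : G → ℝ≥0∞} (F : Finset G) (hF : ∀ z ∉ F, u z = 0) (v : X → ℝ≥0∞)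
    (x : X) : actConv u v x = ∑ z ∈ F, u z * v (z⁻¹ • x) :=
  tsum_eq_sum fun z hz => by simp [hF z hz]

/-- For finitely supported `u` each value of the convolution involves finitely many values of `v`,
so truncating `v` eventually changes nothing there. The condition `K ≠ 0` is for `l2 v = ∞`, because
`0 * ∞ = 0`. -/
theorem ActBound.of_finite_support {u : G → ℝ≥0∞} {K : ℝ≥0∞} (hK : K ≠ 0) (F : Finset G)
    (hF : ∀ z ∉ F, u z = 0)
    (h : ∀ v : X → ℝ≥0∞, (∀ x, v x ≠ ∞) → ∀ E : Finset X, (∀ x ∉ E, v x = 0) →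
      l2 (actConv u v) ≤ K * l2 v) : ActBound X u K := by
  classical
  intro v
  by_cases hv : l2 v = ∞
  · simp [hv, ENNReal.mul_top hK]
  refine l2_le_of_tendsto (l := atTop)
    (t := fun E : Finset X => actConv u (Set.indicator (E : Set X) v)) (fun x => ?_) fun E => ?_
  · simp only [actConv_eq_sum F hF]
    refine tendsto_finsetSum _ fun z _ => tendsto_const_nhds.congr' ?_
    filter_upwards [eventually_ge_atTop {z⁻¹ • x}] with E hE
    rw [Set.indicator_of_mem]
    simpa using hE
  · refine (h _ (fun x => ?_) E fun x hx => by simp [hx]).trans ?_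
    · exact ne_top_of_le_ne_top hv ((Set.indicator_le_self _ _ _).trans (le_l2 v x))
    · gcongr
      exact l2_mono (Set.indicator_le_self _ _)

theorem ActBound.eq_zero {u : G → ℝ≥0∞} (h : ActBound G u 0) (z : G) : u z = 0 := by
  classical
  have h1 := h (fun x => if x = 1 then 1 else 0)
  rw [zero_mul] at h1
  have h2 := l2_eq_zero.1 (le_antisymm h1 zero_le) z
  have h3 := ENNReal.tsum_eq_zero.1 h2 z
  simpa using h3

end truncation

/-! ### Coset sums, coset norms and the majoration principle. -/

section cosets

variable {G : Type*} [Group G] (H : Subgroup G)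

/-- The sums of a function over the left cosets of `H`. -/
def cosetSum (u : G → ℝ≥0∞) : G ⧸ H → ℝ≥0∞ :=
  fun q => ∑' x : {x : G // (x : G ⧸ H) = q}, u x

theorem tsum_cosetSum (u : G → ℝ≥0∞) : ∑' q, cosetSum H u q = ∑' x, u x := by
  rw [← (Equiv.sigmaFiberEquiv (fun x : G => (x : G ⧸ H))).tsum_eq]
  exact (ENNReal.tsum_sigma
    fun (q : G ⧸ H) (x : {x : G // (x : G ⧸ H) = q}) => u x).symm

theorem cosetSum_translate (u : G → ℝ≥0∞) (z : G) (q : G ⧸ H) :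
    cosetSum H (fun x => u (z⁻¹ * x)) q = cosetSum H u (z⁻¹ • q) := by
  refine ((Equiv.mulLeft z⁻¹).subtypeEquiv fun x => ?_).tsum_eq
    (fun y : {y : G // (y : G ⧸ H) = z⁻¹ • q} => u y)
  exact (smul_left_cancel_iff (α := G) (β := G ⧸ H) z⁻¹).symm

theorem cosetSum_mono {u v : G → ℝ≥0∞} (h : ∀ x, u x ≤ v x) (q : G ⧸ H) :
    cosetSum H u q ≤ cosetSum H v q :=
  ENNReal.tsum_le_tsum fun x => h x

/-- The intertwining identity that identifies convolution on the hybrid space, for nonnegative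
functions, with the quasi-regular representation. -/
theorem cosetSum_actConv (u v : G → ℝ≥0∞) :
    cosetSum H (actConv u v) = actConv u (cosetSum H v) := by
  funext q
  simp only [actConv, ← cosetSum_translate]
  simp only [cosetSum, actConv]
  rw [ENNReal.tsum_comm]
  simp only [ENNReal.tsum_mul_left]
  rfl

theorem cosetSum_surjective : Function.Surjective (cosetSum H) := by
  classical
  intro V
  refine ⟨fun x => if (x : G ⧸ H).out = x then V x else 0, ?_⟩
  funext q
  rw [cosetSum, tsum_eq_single ⟨q.out, QuotientGroup.out_eq' q⟩]
  · simp
  · rintro ⟨x, rfl⟩ hx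
    rw [if_neg]
    rintro h
    exact hx (Subtype.ext h.symm)

/-- The `ℓ²` norms of a function over the left cosets of `H`. -/
def cosetNorm (u : G → ℝ≥0∞) : G ⧸ H → ℝ≥0∞ :=
  fun q => l2 fun x : {x : G // (x : G ⧸ H) = q} => u x

theorem cosetNorm_sq (u : G → ℝ≥0∞) (q : G ⧸ H) :
    cosetNorm H u q ^ 2 = cosetSum H (fun x => u x ^ 2) q := l2_sq _

theorem l2_cosetNorm (u : G → ℝ≥0∞) : l2 (cosetNorm H u) = l2 u := by
  unfold l2
  simp_rw [cosetNorm_sq]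
  rw [tsum_cosetSum]

theorem cosetNorm_translate (u : G → ℝ≥0∞) (z : G) (q : G ⧸ H) :
    cosetNorm H (fun x => u (z⁻¹ * x)) q = cosetNorm H u (z⁻¹ • q) := by
  have := cosetSum_translate H (fun x => u x ^ 2) z q
  rw [← cosetNorm_sq, ← cosetNorm_sq] at this
  exact le_antisymm ((ENNReal.pow_le_pow_left_iff two_ne_zero).1 this.le)
    ((ENNReal.pow_le_pow_left_iff two_ne_zero).1 this.ge)

theorem cosetNorm_le_cosetSum (u : G → ℝ≥0∞) (q : G ⧸ H) : cosetNorm H u q ≤ cosetSum H u q := by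
  refine l2_le_iff.2 ?_
  rw [sq (cosetSum H u q), cosetSum, ← ENNReal.tsum_mul_left]
  refine ENNReal.tsum_le_tsum fun x => ?_
  rw [sq]
  gcongr
  exact ENNReal.le_tsum (f := fun x : {x : G // (x : G ⧸ H) = q} => u x) x

theorem l2_le_l2_cosetSum (u : G → ℝ≥0∞) : l2 u ≤ l2 (cosetSum H u) := by
  rw [← l2_cosetNorm H]
  exact l2_mono (cosetNorm_le_cosetSum H u)

/-- Herz's majoration principle: the norm of a nonnegative function in the regular representation
is at most its norm in a quasi-regular representation. -/
theorem ActBound.of_quotient {u : G → ℝ≥0∞} {K : ℝ≥0∞} (h : ActBound (G ⧸ H) u K) :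
    ActBound G u K := fun v => by
  calc l2 (actConv u v) = l2 (cosetNorm H (actConv u v)) := (l2_cosetNorm H _).symm
    _ ≤ l2 (actConv u (cosetNorm H v)) := l2_mono fun q => ?_
    _ ≤ K * l2 (cosetNorm H v) := h _
    _ = K * l2 v := by rw [l2_cosetNorm]
  -- Minkowski's inequality on the coset `q`, where the convolution is a sum of translates of `v`.
  refine (l2_tsum_le (fun z (x : {x : G // (x : G ⧸ H) = q}) => u z * v (z⁻¹ • (x : G)))).trans
    (ENNReal.tsum_le_tsum fun z => ?_)
  rw [l2_const_mul, ← cosetNorm_translate]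
  rfl

end cosets

section weight

variable {G : Type*} {ℓ : G → ℕ}

/-- The weight `(1 + ℓ)^k` of the Sobolev norms. -/
def lengthWeight (ℓ : G → ℕ) (k : ℕ) (x : G) : ℝ≥0∞ := (1 + (ℓ x : ℝ≥0∞)) ^ k

theorem lengthWeight_ne_zero (k : ℕ) (x : G) : lengthWeight ℓ k x ≠ 0 := by
  simp [lengthWeight]

theorem lengthWeight_ne_top (k : ℕ) (x : G) : lengthWeight ℓ k x ≠ ∞ := by
  simp [lengthWeight]

theorem one_le_lengthWeight (k : ℕ) (x : G) : 1 ≤ lengthWeight ℓ k x :=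
  one_le_pow₀ le_self_add

theorem lengthWeight_mono {k m : ℕ} (h : k ≤ m) (x : G) :
    lengthWeight ℓ k x ≤ lengthWeight ℓ m x :=
  pow_le_pow_right₀ le_self_add h

theorem lengthWeight_add (k m : ℕ) (x : G) :
    lengthWeight ℓ (k + m) x = lengthWeight ℓ k x * lengthWeight ℓ m x := pow_add _ _ _

end weight

/-! ### Polynomial growth and comparison of Sobolev norms. -/

section growth

variable {G : Type*} [Group G] {H : Subgroup G} {ℓ : G → ℕ}

open Classical in
/-- The number of elements of the subset `A` in the ball of radius `n`. -/
def ballCount (ℓ : G → ℕ) (A : Set G) (n : ℕ) : ℝ≥0∞ :=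
  ∑' x : A, if ℓ x ≤ n then 1 else 0

/-- Left translation by the inverse of one element of the coset in the ball carries the others into
`H` and at most doubles the radius. -/
theorem ballCount_coset_le (hmul : ∀ x y, ℓ (x * y) ≤ ℓ x + ℓ y) (hinv : ∀ x, ℓ x⁻¹ = ℓ x)
    (q : G ⧸ H) (n : ℕ) :
    ballCount ℓ {x : G | (x : G ⧸ H) = q} n ≤ ballCount ℓ (H : Set G) (2 * n) := by
  classical
  by_cases hq : ∃ x : G, (x : G ⧸ H) = q ∧ ℓ x ≤ n
  · obtain ⟨y, rfl, hy⟩ := hq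
    let i : {x : G | (x : G ⧸ H) = y} → (H : Set G) :=
      fun x => ⟨y⁻¹ * x, QuotientGroup.eq.1 x.2.symm⟩
    have hi : Function.Injective i := fun x x' h => by
      simpa [i, Subtype.ext_iff] using h
    refine le_trans (ENNReal.tsum_le_tsum fun x => ?_) (ENNReal.tsum_comp_le_tsum_of_injective hi _)
    split_ifs with h1 h2
    · exact le_rfl
    · refine absurd ?_ h2
      have := hmul y⁻¹ x
      rw [hinv] at this
      exact this.trans (by omega)
    · exact zero_le
    · exact le_rfl
  · push Not at hq
    have : ballCount ℓ {x : G | (x : G ⧸ H) = q} n = 0 :=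
      ENNReal.tsum_eq_zero.2 fun x => if_neg (not_le.2 (hq x x.2))
    simp [this]

theorem tsum_inv_sq_ne_top : ∑' n : ℕ, ((1 + (n : ℝ≥0∞)) ^ 2)⁻¹ ≠ ∞ := by
  have h : Summable fun n : ℕ => (((n + 1 : ℕ) : ℝ) ^ 2)⁻¹ :=
    (summable_nat_add_iff 1).2 (Real.summable_nat_pow_inv.2 one_lt_two)
  have h2 := h.tsum_ofReal_ne_top
  convert h2 using 4 with n
  rw [ENNReal.ofReal_inv_of_pos (by positivity), ENNReal.ofReal_pow (by positivity),
    ENNReal.ofReal_natCast]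
  push_cast
  rw [add_comm]

/-- Dominate each term by a sum over all radii `n ≥ ℓ x` and count coset points in balls. Of the
exponent `d + 2`, the growth absorbs `d` and the remaining `2` gives a convergent series; `2 ^ d`
comes from doubling the radius. -/
theorem tsum_coset_inv_lengthWeight_le (hmul : ∀ x y, ℓ (x * y) ≤ ℓ x + ℓ y)
    (hinv : ∀ x, ℓ x⁻¹ = ℓ x) {C : ℝ≥0∞} {d : ℕ}
    (hg : ∀ n : ℕ, ballCount ℓ (H : Set G) n ≤ C * (1 + n) ^ d) (q : G ⧸ H) :
    cosetSum H (fun x => (lengthWeight ℓ (d + 2) x)⁻¹) q ≤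
      C * 2 ^ d * ∑' n : ℕ, ((1 + (n : ℝ≥0∞)) ^ 2)⁻¹ := by
  classical
  calc cosetSum H (fun x => (lengthWeight ℓ (d + 2) x)⁻¹) q
      ≤ ∑' (x : {x : G // (x : G ⧸ H) = q}) (n : ℕ),
          (if ℓ x ≤ n then 1 else 0) * ((1 + (n : ℝ≥0∞)) ^ (d + 2))⁻¹ :=
        ENNReal.tsum_le_tsum fun x => by
          refine le_trans ?_ (ENNReal.le_tsum (ℓ x))
          simp [lengthWeight]
    _ = ∑' n : ℕ, ballCount ℓ {x : G | (x : G ⧸ H) = q} n * ((1 + (n : ℝ≥0∞)) ^ (d + 2))⁻¹ := by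
        rw [ENNReal.tsum_comm]
        simp_rw [ENNReal.tsum_mul_right]
        rfl
    _ ≤ ∑' n : ℕ, C * 2 ^ d * ((1 + (n : ℝ≥0∞)) ^ 2)⁻¹ := ENNReal.tsum_le_tsum fun n => by
        have h1 : (1 + ((2 * n : ℕ) : ℝ≥0∞)) ≤ 2 * (1 + n) := by
          have : ((1 + 2 * n : ℕ) : ℝ≥0∞) ≤ ((2 * (1 + n) : ℕ) : ℝ≥0∞) := by
            exact_mod_cast (by omega : 1 + 2 * n ≤ 2 * (1 + n))
          push_cast at this ⊢
          exact this
        have h2 : ballCount ℓ {x : G | (x : G ⧸ H) = q} n ≤ C * 2 ^ d * (1 + n) ^ d := by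
          refine (ballCount_coset_le hmul hinv q n).trans ((hg _).trans ?_)
          rw [mul_assoc, ← mul_pow]
          gcongr
        have h3 : ((1 + (n : ℝ≥0∞)) ^ d) ≠ 0 := by simp
        have h4 : ((1 + (n : ℝ≥0∞)) ^ d) ≠ ∞ := by simp
        calc _ ≤ C * 2 ^ d * (1 + n) ^ d * ((1 + (n : ℝ≥0∞)) ^ (d + 2))⁻¹ := by gcongr
          _ = C * 2 ^ d * (((1 + n) ^ d) * ((1 + (n : ℝ≥0∞)) ^ d)⁻¹) *
              ((1 + (n : ℝ≥0∞)) ^ 2)⁻¹ := by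
            rw [pow_add, ENNReal.mul_inv (Or.inl h3) (Or.inl h4)]
            ring
          _ = _ := by rw [ENNReal.mul_inv_cancel h3 h4, mul_one]
    _ = _ := ENNReal.tsum_mul_left

/-- For a subgroup of polynomial growth the hybrid Sobolev norms are controlled by the
usual ones. -/
theorem l2_cosetSum_lengthWeight_le (hmul : ∀ x y, ℓ (x * y) ≤ ℓ x + ℓ y)
    (hinv : ∀ x, ℓ x⁻¹ = ℓ x) {C : ℝ≥0∞} (hC : C ≠ ∞) {d : ℕ}
    (hg : ∀ n : ℕ, ballCount ℓ (H : Set G) n ≤ C * (1 + n) ^ d) (k : ℕ) :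
    ∃ D : ℝ≥0∞, D ≠ ∞ ∧ ∀ u : G → ℝ≥0∞,
      l2 (cosetSum H fun x => u x * lengthWeight ℓ k x) ≤
        D * l2 fun x => u x * lengthWeight ℓ (k + (d + 2)) x := by
  set D : ℝ≥0∞ := C * 2 ^ d * ∑' n : ℕ, ((1 + (n : ℝ≥0∞)) ^ 2)⁻¹ with hD
  have hDt : D ≠ ∞ := ENNReal.mul_ne_top (ENNReal.mul_ne_top hC (by simp)) tsum_inv_sq_ne_top
  refine ⟨D ^ (1 / 2 : ℝ), ENNReal.rpow_ne_top_of_nonneg (by norm_num) hDt, fun u => ?_⟩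
  rw [← l2_cosetNorm H (fun x => u x * lengthWeight ℓ (k + (d + 2)) x), ← l2_const_mul]
  refine l2_mono fun q => ?_
  have h1 : ∀ x, u x * lengthWeight ℓ k x =
      (lengthWeight ℓ (d + 2) x)⁻¹ * (u x * lengthWeight ℓ (k + (d + 2)) x) := fun x => by
    rw [lengthWeight_add k (d + 2)]
    calc u x * lengthWeight ℓ k x = (lengthWeight ℓ (d + 2) x)⁻¹ * lengthWeight ℓ (d + 2) x *
          (u x * lengthWeight ℓ k x) := by
          rw [ENNReal.inv_mul_cancel (lengthWeight_ne_zero _ _) (lengthWeight_ne_top _ _), one_mul]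
      _ = _ := by ring
  simp_rw [h1]
  -- Cauchy–Schwarz on the coset. Since the inverse weight is at most `1`, its square is bounded by
  -- itself, whose coset sum is at most `D`.
  refine (tsum_mul_le_l2 _ _).trans ?_
  refine mul_le_mul' ?_ le_rfl
  rw [l2_le_iff, sqrt_sq]
  refine le_trans ?_ (tsum_coset_inv_lengthWeight_le hmul hinv hg q)
  refine ENNReal.tsum_le_tsum fun x => ?_
  rw [sq]
  exact mul_le_of_le_one_left' (ENNReal.inv_le_one.2 (one_le_lengthWeight _ _))

end growth

/-! ### Quasi-regular norm bounded by the regular norm: the power trick. -/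

section power

open Filter Topology

/-- A log-convex sequence of exponential growth rate at most `K` has first ratio at most `K`. -/
theorem ratio_le_of_logConvex {m : ℕ → ℝ} {K A : ℝ} {d : ℕ} (hm : ∀ n, 0 ≤ m n) (hK : 0 ≤ K)
    (hlog : ∀ n, m (n + 1) ^ 2 ≤ m n * m (n + 2))
    (hbound : ∀ n : ℕ, m n ≤ A * (1 + n) ^ d * K ^ n) : m 1 ≤ K * m 0 := by
  by_contra! hlt
  have h1 : 0 < m 1 := (mul_nonneg hK (hm 0)).trans_lt hlt
  have h0 : 0 < m 0 := by
    refine lt_of_le_of_ne (hm 0) fun h => ?_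
    have := hlog 0
    simp only [← h, zero_mul, zero_add] at this
    nlinarith
  set r := m 1 / m 0 with hr
  have hr0 : 0 < r := div_pos h1 h0
  have hrK : K < r := (lt_div_iff₀ h0).2 hlt
  -- Log-convexity makes successive ratios nondecreasing, so all are at least the first ratio `r`;
  -- with `r > K` this outgrows any polynomial times `K ^ n`.
  have hstep : ∀ n, 0 < m n ∧ r * m n ≤ m (n + 1) := by
    intro n
    induction n with
    | zero => exact ⟨h0, by rw [hr, div_mul_cancel₀ _ h0.ne']⟩
    | succ n ih =>
      obtain ⟨ih1, ih2⟩ := ih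
      have hpos : 0 < m (n + 1) := (mul_pos hr0 ih1).trans_le ih2
      refine ⟨hpos, ?_⟩
      refine le_of_mul_le_mul_left ?_ ih1
      calc m n * (r * m (n + 1)) = (r * m n) * m (n + 1) := by ring
        _ ≤ m (n + 1) * m (n + 1) := by gcongr
        _ ≤ m n * m (n + 2) := by rw [← sq]; exact hlog n
  have hlow : ∀ n, m 0 * r ^ n ≤ m n := by
    intro n
    induction n with
    | zero => simp
    | succ n ih =>
      calc m 0 * r ^ (n + 1) = r * (m 0 * r ^ n) := by ring
        _ ≤ r * m n := by gcongr
        _ ≤ m (n + 1) := (hstep n).2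
  have hratio : ∀ n : ℕ, m 0 ≤ A * ((1 + n) ^ d * (K / r) ^ n) := fun n => by
    have h2 := (hlow n).trans (hbound n)
    rw [div_pow, mul_div_assoc', mul_div_assoc', le_div_iff₀ (by positivity)]
    linarith
  have hlim : Tendsto (fun n : ℕ => A * ((1 + n : ℝ) ^ d * (K / r) ^ n)) atTop (𝓝 0) := by
    rw [← mul_zero A]
    refine Tendsto.const_mul _ ?_
    have hq : K / r < 1 := (div_lt_one hr0).2 hrK
    have h2 := tendsto_pow_const_mul_const_pow_of_lt_one d (div_nonneg hK hr0.le) hq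
    have h3 : Tendsto (fun n : ℕ => (2 : ℝ) ^ d * ((n : ℝ) ^ d * (K / r) ^ n)) atTop (𝓝 0) := by
      simpa using h2.const_mul ((2 : ℝ) ^ d)
    refine squeeze_zero' (Eventually.of_forall fun n => ?_) ?_ h3
    · have := div_nonneg hK hr0.le
      positivity
    · filter_upwards [eventually_ge_atTop 1] with n hn
      have hn' : (1 : ℝ) ≤ n := by exact_mod_cast hn
      have := div_nonneg hK hr0.le
      rw [← mul_assoc, ← mul_pow]
      gcongr
      linarith
  exact absurd (ge_of_tendsto' hlim hratio) (not_le.2 h0)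

variable {G X : Type*} [Group G] [MulAction G X]

/-- The images of `v` under alternating applications of convolution by `u` and its adjoint. -/
def altConv (u : G → ℝ≥0∞) (v : X → ℝ≥0∞) : ℕ → X → ℝ≥0∞
  | 0 => v
  | n + 1 => actConv (if Even n then u else fun z => u z⁻¹) (altConv u v n)

theorem l2_altConv_le {u : G → ℝ≥0∞} {K : ℝ≥0∞} (h : ActBound X u K) (v : X → ℝ≥0∞) (n : ℕ) :
    l2 (altConv u v n) ≤ K ^ n * l2 v := by
  induction n with
  | zero => simp [altConv]
  | succ n ih =>
    have h1 : ActBound X (if Even n then u else fun z => u z⁻¹) K := by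
      split_ifs
      exacts [h, h.adjoint]
    refine (h1 _).trans ?_
    rw [pow_succ', mul_assoc]
    gcongr

/-- Moving the last operator of one factor across the pairing of the `(n + 1)`-st iterate with
itself pairs iterates `n` and `n + 2`, because the operators alternate with their adjoints. -/
theorem l2_altConv_sq_le (u : G → ℝ≥0∞) (v : X → ℝ≥0∞) (n : ℕ) :
    l2 (altConv u v (n + 1)) ^ 2 ≤ l2 (altConv u v n) * l2 (altConv u v (n + 2)) := by
  rw [l2_sq]
  refine le_trans (le_of_eq ?_) (tsum_mul_le_l2 _ _)
  simp_rw [sq]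
  conv_lhs => enter [1, x, 1]; rw [altConv]
  rw [tsum_actConv_mul]
  rw [altConv.eq_2 u v (n + 1)]
  congr! 4 with x
  by_cases hn : Even n <;> simp [hn, Nat.even_add_one]

variable {H : Subgroup G} {ℓ : G → ℕ}

open Classical in
/-- The lift to `G` of a function on `G ⧸ H`, cut off outside of a ball. -/
def ballLift (ℓ : G → ℕ) (v : G ⧸ H → ℝ≥0∞) (M : ℕ) : G → ℝ≥0∞ :=
  fun x => if ℓ x ≤ M then v x else 0

theorem l2_ballLift_sq_le (hmul : ∀ x y, ℓ (x * y) ≤ ℓ x + ℓ y) (hinv : ∀ x, ℓ x⁻¹ = ℓ x)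
    (v : G ⧸ H → ℝ≥0∞) (M : ℕ) :
    l2 (ballLift ℓ v M) ^ 2 ≤ ballCount ℓ (H : Set G) (2 * M) * l2 v ^ 2 := by
  classical
  rw [l2_sq, l2_sq, ← tsum_cosetSum H, ← ENNReal.tsum_mul_left]
  refine ENNReal.tsum_le_tsum fun q => ?_
  refine le_trans (le_of_eq ?_) (mul_le_mul' (ballCount_coset_le hmul hinv q M) le_rfl)
  rw [ballCount, ← ENNReal.tsum_mul_right]
  refine tsum_congr fun x => ?_
  have hx : ((x : G) : G ⧸ H) = q := x.2
  simp only [ballLift, hx]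
  split_ifs <;> simp

/-- Finite propagation: `n` steps of length at most `R` starting from `x` never leave the ball of
radius `M`, so the cut-off is not seen. -/
theorem altConv_le_altConv_ballLift (hmul : ∀ x y, ℓ (x * y) ≤ ℓ x + ℓ y)
    (hinv : ∀ x, ℓ x⁻¹ = ℓ x) {u : G → ℝ≥0∞} {R : ℕ} (hu : ∀ z, u z ≠ 0 → ℓ z ≤ R)
    (v : G ⧸ H → ℝ≥0∞) (M n : ℕ) (x : G) (hx : ℓ x + n * R ≤ M) :
    altConv u v n x ≤ altConv u (ballLift ℓ v M) n x := by
  induction n generalizing x with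
  | zero => simp [altConv, ballLift, show ℓ x ≤ M by omega]
  | succ n ih =>
    refine ENNReal.tsum_le_tsum fun z => ?_
    by_cases hz : (if Even n then u else fun z => u z⁻¹) z = 0
    · simp [hz]
    · have hzR : ℓ z ≤ R := by
        split_ifs at hz
        · exact hu z hz
        · rw [← hinv]; exact hu _ hz
      gcongr
      refine ih (z⁻¹ * x) ?_
      have := hmul z⁻¹ x
      rw [hinv] at this
      rw [Nat.succ_mul] at hx
      omega

theorem exists_length_le_of_altConv_ne_zero (hmul : ∀ x y, ℓ (x * y) ≤ ℓ x + ℓ y)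
    (hinv : ∀ x, ℓ x⁻¹ = ℓ x) {u : G → ℝ≥0∞} {R : ℕ} (hu : ∀ z, u z ≠ 0 → ℓ z ≤ R)
    {v : G ⧸ H → ℝ≥0∞} {L : ℕ} (hv : ∀ q, v q ≠ 0 → ∃ x : G, (x : G ⧸ H) = q ∧ ℓ x ≤ L)
    (n : ℕ) (q : G ⧸ H) (hq : altConv u v n q ≠ 0) :
    ∃ x : G, (x : G ⧸ H) = q ∧ ℓ x ≤ L + n * R := by
  induction n generalizing q with
  | zero => simpa using hv q hq
  | succ n ih =>
    obtain ⟨z, hz, hzq⟩ := actConv_ne_zero hq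
    obtain ⟨x, hx, hxL⟩ := ih _ hzq
    refine ⟨z * x, ?_, ?_⟩
    · rw [← smul_eq_mul, ← MulAction.Quotient.smul_coe, hx, smul_inv_smul]
    · have hzR : ℓ z ≤ R := by
        split_ifs at hz
        · exact hu z hz
        · rw [← hinv]; exact hu _ hz
      have := hmul z x
      rw [Nat.succ_mul]
      omega

theorem l2_altConv_sq_le_of_growth (hmul : ∀ x y, ℓ (x * y) ≤ ℓ x + ℓ y)
    (hinv : ∀ x, ℓ x⁻¹ = ℓ x) {u : G → ℝ≥0∞} {R : ℕ} (hu : ∀ z, u z ≠ 0 → ℓ z ≤ R)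
    {v : G ⧸ H → ℝ≥0∞} {L : ℕ} (hv : ∀ q, v q ≠ 0 → ∃ x : G, (x : G ⧸ H) = q ∧ ℓ x ≤ L)
    {K : ℝ≥0∞} (h : ActBound G u K) (n : ℕ) :
    l2 (altConv u v n) ^ 2 ≤
      (K ^ 2) ^ n * (ballCount ℓ (H : Set G) (2 * (L + 2 * (n * R))) * l2 v ^ 2) := by
  classical
  -- Every coset where the iterate is nonzero has a representative of length at most `L + n * R`;
  -- another `n * R` is needed for the propagation from it.
  set M := L + 2 * (n * R) with hM
  have h1 : l2 (altConv u v n) ≤ l2 (altConv u (ballLift ℓ v M) n) := by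
    rw [← l2_cosetNorm H (altConv u (ballLift ℓ v M) n)]
    refine l2_mono fun q => ?_
    by_cases hq : altConv u v n q = 0
    · simp [hq]
    · obtain ⟨x, rfl, hx⟩ := exists_length_le_of_altConv_ne_zero hmul hinv hu hv n q hq
      refine (altConv_le_altConv_ballLift hmul hinv hu v M n x (by omega)).trans ?_
      exact le_l2 (fun y : {y : G // (y : G ⧸ H) = x} => altConv u (ballLift ℓ v M) n y) ⟨x, rfl⟩
  calc l2 (altConv u v n) ^ 2 ≤ (K ^ n * l2 (ballLift ℓ v M)) ^ 2 := by
        gcongr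
        exact h1.trans (l2_altConv_le h _ n)
    _ = (K ^ 2) ^ n * l2 (ballLift ℓ v M) ^ 2 := by rw [mul_pow]; ring
    _ ≤ _ := by gcongr; exact l2_ballLift_sq_le hmul hinv v M

/-- For a subgroup of polynomial growth, the norm of a finitely supported nonnegative function in
the quasi-regular representation is at most its norm in the regular representation. -/
theorem ActBound.to_quotient (hmul : ∀ x y, ℓ (x * y) ≤ ℓ x + ℓ y) (hinv : ∀ x, ℓ x⁻¹ = ℓ x)
    {C : ℝ≥0∞} (hC : C ≠ ∞) {d : ℕ}
    (hg : ∀ n : ℕ, ballCount ℓ (H : Set G) n ≤ C * (1 + n) ^ d)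
    {u : G → ℝ≥0∞} (F : Finset G) (hF : ∀ z ∉ F, u z = 0) {K : ℝ≥0∞} (hK : K ≠ ∞)
    (h : ActBound G u K) : ActBound (G ⧸ H) u K := by
  rcases eq_or_ne K 0 with rfl | hK0
  · have : u = fun _ => 0 := funext h.eq_zero
    rw [this]
    exact actBound_zero
  refine ActBound.of_finite_support hK0 F hF fun v hv E hE => ?_
  set R := F.sup ℓ with hR
  have hu : ∀ z, u z ≠ 0 → ℓ z ≤ R := fun z hz =>
    Finset.le_sup (by by_contra hc; exact hz (hF z hc))
  set L := E.sup fun q => ℓ q.out with hL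
  have hvL : ∀ q, v q ≠ 0 → ∃ x : G, (x : G ⧸ H) = q ∧ ℓ x ≤ L := fun q hq =>
    ⟨q.out, QuotientGroup.out_eq' q, Finset.le_sup (f := fun q : G ⧸ H => ℓ q.out)
      (by by_contra hc; exact hq (hE q hc))⟩
  have hvt : l2 v ≠ ∞ := l2_ne_top_of_finite_support E hE hv
  -- Chosen so that `1 + 2 * (L + 2 * n * R) ≤ B * (1 + n)`.
  set B : ℕ := 1 + 2 * L + 4 * R with hB
  set A : ℝ≥0∞ := C * B ^ d * l2 v ^ 2 with hA
  have hAt : A ≠ ∞ := by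
    refine ENNReal.mul_ne_top (ENNReal.mul_ne_top hC (by simp)) (by simp [hvt])
  have hbound : ∀ n : ℕ, l2 (altConv u v n) ^ 2 ≤ A * (1 + n) ^ d * (K ^ 2) ^ n := fun n => by
    refine (l2_altConv_sq_le_of_growth hmul hinv hu hvL h n).trans ?_
    have h1 : (1 + ((2 * (L + 2 * (n * R)) : ℕ) : ℝ≥0∞)) ≤ B * (1 + n) := by
      have : 1 + 2 * (L + 2 * (n * R)) ≤ B * (1 + n) := by
        rw [hB]; ring_nf; nlinarith [Nat.zero_le (n * L)]
      exact_mod_cast this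
    calc (K ^ 2) ^ n * (ballCount ℓ (H : Set G) (2 * (L + 2 * (n * R))) * l2 v ^ 2)
        ≤ (K ^ 2) ^ n * (C * (B * (1 + n)) ^ d * l2 v ^ 2) := by
          gcongr
          exact (hg _).trans (by gcongr)
      _ = A * (1 + n) ^ d * (K ^ 2) ^ n := by rw [hA, mul_pow]; ring
  have hfin : ∀ n, l2 (altConv u v n) ^ 2 ≠ ∞ := fun n => by
    refine ne_top_of_le_ne_top ?_ (hbound n)
    refine ENNReal.mul_ne_top (ENNReal.mul_ne_top hAt (by simp)) (by simp [hK])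
  have key := ratio_le_of_logConvex (m := fun n => (l2 (altConv u v n) ^ 2).toReal)
    (K := (K ^ 2).toReal) (A := A.toReal) (d := d) (fun n => ENNReal.toReal_nonneg)
    ENNReal.toReal_nonneg (fun n => ?_) (fun n => ?_)
  · rw [← ENNReal.toReal_mul] at key
    have h1 := (ENNReal.toReal_le_toReal (hfin 1)
      (ENNReal.mul_ne_top (by simp [hK]) (hfin 0))).1 key
    rw [← mul_pow, ENNReal.pow_le_pow_left_iff two_ne_zero] at h1
    simpa [altConv] using h1
  · rw [← ENNReal.toReal_mul, ← ENNReal.toReal_pow]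
    refine ENNReal.toReal_mono (ENNReal.mul_ne_top (hfin _) (hfin _)) ?_
    rw [← mul_pow]
    gcongr
    exact l2_altConv_sq_le u v n
  · have h1 := ENNReal.toReal_mono ?_ (hbound n)
    · refine h1.trans (le_of_eq ?_)
      rw [ENNReal.toReal_mul, ENNReal.toReal_mul, ENNReal.toReal_pow, ENNReal.toReal_pow,
        ENNReal.toReal_add (by simp) (by simp)]
      simp
    · exact ENNReal.mul_ne_top (ENNReal.mul_ne_top hAt (by simp)) (by simp [hK])

end power

/-! ### Complex convolution operators and a common model for both function spaces. -/

section convolution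

variable {G : Type*} [Group G]

theorem enorm_convolution_le (ξ φ : G → ℂ) (x : G) :
    ‖convolution ξ φ x‖ₑ ≤ actConv (fun z => ‖ξ z‖ₑ) (fun y => ‖φ y‖ₑ) x := by
  refine (enorm_tsum_le_tsum_enorm (f := fun z => ξ z * φ (z⁻¹ * x))).trans (le_of_eq ?_)
  exact tsum_congr fun z => enorm_mul _ _

theorem summable_convolution {ξ φ : G → ℂ} {x : G}
    (h : actConv (fun z => ‖ξ z‖ₑ) (fun y => ‖φ y‖ₑ) x ≠ ∞) :
    Summable fun z => ξ z * φ (z⁻¹ * x) := by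
  refine Summable.of_norm ?_
  have := ENNReal.summable_toReal h
  simpa using this

theorem actConv_le_l2 (u v : G → ℝ≥0∞) (x : G) : actConv u v x ≤ l2 u * l2 v := by
  refine (tsum_mul_le_l2 _ _).trans (le_of_eq ?_)
  congr 1
  rw [l2, l2]
  congr 1
  exact ((Equiv.inv G).trans (Equiv.mulRight x)).tsum_eq fun y => v y ^ 2

/-- Convolution of nonnegative functions, computed in `ℂ`. -/
theorem enorm_convolution_toReal {u v : G → ℝ≥0∞} {x : G} (h : actConv u v x ≠ ∞) :
    ‖convolution (fun z => (((u z).toReal : ℝ) : ℂ)) (fun z => (((v z).toReal : ℝ) : ℂ)) x‖ₑ =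
      actConv u v x := by
  have h1 : convolution (fun z => (((u z).toReal : ℝ) : ℂ)) (fun z => (((v z).toReal : ℝ) : ℂ)) x
      = (((actConv u v x).toReal : ℝ) : ℂ) := by
    rw [actConv, ENNReal.tsum_toReal_eq fun z => ENNReal.ne_top_of_tsum_ne_top h z,
      Complex.ofReal_tsum]
    exact tsum_congr fun z => by simp
  rw [h1, ← ofReal_norm, Complex.norm_real, Real.norm_of_nonneg ENNReal.toReal_nonneg,
    ENNReal.ofReal_toReal h]

theorem enorm_ofReal_toReal {a : ℝ≥0∞} (h : a ≠ ∞) : ‖((a.toReal : ℝ) : ℂ)‖ₑ = a := by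
  rw [← ofReal_norm, Complex.norm_real, Real.norm_of_nonneg ENNReal.toReal_nonneg,
    ENNReal.ofReal_toReal h]

end convolution

/-- A Banach space `E` of functions on `G` whose norm is the `ℓ²` norm of a function on a
`G`-set `X` obtained by an equivariant operation on nonnegative functions. -/
structure ConvolutionModel (G X E : Type*) [Group G] [MulAction G X] [NormedAddCommGroup E]
    [NormedSpace ℂ E] where
  toFun : E →ₗ[ℂ] (G → ℂ)
  push : (G → ℝ≥0∞) → X → ℝ≥0∞
  enorm_eq : ∀ φ, ‖φ‖ₑ = l2 (push fun x => ‖toFun φ x‖ₑ)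
  exists_toFun_eq : ∀ f : G → ℂ, l2 (push fun x => ‖f x‖ₑ) ≠ ∞ → ∃ φ, toFun φ = f
  push_mono : ∀ u v : G → ℝ≥0∞, (∀ x, u x ≤ v x) → ∀ q, push u q ≤ push v q
  push_actConv : ∀ u v : G → ℝ≥0∞, push (actConv u v) = actConv u (push v)
  push_surjective : Function.Surjective push
  l2_le : ∀ u : G → ℝ≥0∞, l2 u ≤ l2 (push u)

namespace ConvolutionModel

variable {G X E : Type*} [Group G] [MulAction G X] [NormedAddCommGroup E] [NormedSpace ℂ E]
  (M : ConvolutionModel G X E)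

/-- By monotonicity `push 0` lies below a preimage's image, namely `0`, so an element with zero
function has zero norm. -/
theorem toFun_injective : Function.Injective M.toFun := by
  refine (injective_iff_map_eq_zero M.toFun).2 fun φ hφ => ?_
  rw [← enorm_eq_zero, M.enorm_eq, hφ]
  obtain ⟨v, hv⟩ := M.push_surjective fun _ => 0
  have h1 : M.push (fun _ => 0) = fun _ => 0 := funext fun q =>
    le_antisymm ((M.push_mono _ v (fun x => zero_le) q).trans (congrFun hv q).le) zero_le
  simp [h1, l2]

theorem l2_push_actConv_le {u : G → ℝ≥0∞} {K : ℝ≥0∞} (h : ActBound X u K) (φ : E) :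
    l2 (M.push (actConv u fun y => ‖M.toFun φ y‖ₑ)) ≤ K * ‖φ‖ₑ := by
  rw [M.push_actConv, M.enorm_eq]
  exact h _

theorem actConv_ne_top {u : G → ℝ≥0∞} {K : ℝ≥0∞} (hK : K ≠ ∞) (h : ActBound X u K) (φ : E)
    (x : G) : actConv u (fun y => ‖M.toFun φ y‖ₑ) x ≠ ∞ :=
  ne_top_of_le_ne_top (ENNReal.mul_ne_top hK enorm_ne_top)
    ((le_l2 _ x).trans ((M.l2_le _).trans (M.l2_push_actConv_le h φ)))

/-- `T` is the operator of left convolution by `ξ`. -/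
def IsConvolution (ξ : G → ℂ) (T : E →L[ℂ] E) : Prop :=
  ∀ φ, M.toFun (T φ) = convolution ξ (M.toFun φ)

theorem l2_push_convolution_le {ξ : G → ℂ} {K : ℝ≥0∞} (h : ActBound X (fun z => ‖ξ z‖ₑ) K)
    (φ : E) : l2 (M.push fun x => ‖convolution ξ (M.toFun φ) x‖ₑ) ≤ K * ‖φ‖ₑ :=
  (l2_mono (M.push_mono _ _ (enorm_convolution_le _ _))).trans (M.l2_push_actConv_le h φ)

theorem enorm_le_of_isConvolution {ξ : G → ℂ} {K : ℝ≥0∞} (hK : K ≠ ∞)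
    (h : ActBound X (fun z => ‖ξ z‖ₑ) K) {T : E →L[ℂ] E} (hT : M.IsConvolution ξ T) :
    ‖T‖ ≤ K.toReal := by
  refine T.opNorm_le_bound ENNReal.toReal_nonneg fun φ => ?_
  rw [← toReal_enorm, ← toReal_enorm, ← ENNReal.toReal_mul]
  refine ENNReal.toReal_mono (ENNReal.mul_ne_top hK enorm_ne_top) ?_
  rw [M.enorm_eq, hT φ]
  exact M.l2_push_convolution_le h φ

theorem exists_isConvolution {ξ : G → ℂ} {K : ℝ≥0∞} (hK : K ≠ ∞)
    (h : ActBound X (fun z => ‖ξ z‖ₑ) K) : ∃ T : E →L[ℂ] E, M.IsConvolution ξ T := by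
  have hfin (φ : E) := ne_top_of_le_ne_top (ENNReal.mul_ne_top hK enorm_ne_top)
    (M.l2_push_convolution_le h φ)
  choose T hT using fun φ : E => M.exists_toFun_eq _ (hfin φ)
  have hsum (φ : E) (x : G) := summable_convolution (M.actConv_ne_top hK h φ x)
  let T' : E →ₗ[ℂ] E :=
    { toFun := T
      map_add' := fun φ ψ => M.toFun_injective <| by
        rw [map_add, hT, hT, hT, map_add]
        funext x
        simp only [convolution, Pi.add_apply, mul_add]
        exact (hsum φ x).tsum_add (hsum ψ x)
      map_smul' := fun c φ => M.toFun_injective <| by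
        rw [RingHom.id_apply, map_smul, hT, hT, map_smul]
        funext x
        simp only [convolution, Pi.smul_apply, smul_eq_mul, ← tsum_mul_left]
        exact tsum_congr fun z => by ring }
  refine ⟨T'.mkContinuous K.toReal fun φ => ?_, fun φ => hT φ⟩
  rw [← toReal_enorm, ← toReal_enorm, ← ENNReal.toReal_mul]
  refine ENNReal.toReal_mono (ENNReal.mul_ne_top hK enorm_ne_top) ?_
  rw [M.enorm_eq]
  change l2 (M.push fun x => ‖M.toFun (T φ) x‖ₑ) ≤ _
  rw [hT φ]
  exact M.l2_push_convolution_le h φ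

theorem isConvolution_sub {ξ η : G → ℂ} {K L : ℝ≥0∞} (hK : K ≠ ∞) (hL : L ≠ ∞)
    (hξ : ActBound X (fun z => ‖ξ z‖ₑ) K) (hη : ActBound X (fun z => ‖η z‖ₑ) L)
    {T U : E →L[ℂ] E} (hT : M.IsConvolution ξ T) (hU : M.IsConvolution η U) :
    M.IsConvolution (fun z => ξ z - η z) (T - U) := fun φ => by
  rw [sub_apply, map_sub, hT, hU]
  funext x
  simp only [convolution, Pi.sub_apply, sub_mul]
  exact ((summable_convolution (M.actConv_ne_top hK hξ φ x)).tsum_sub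
    (summable_convolution (M.actConv_ne_top hL hη φ x))).symm

open Filter Topology in
/-- If convolution norms on `X` are controlled by weighted `ℓ²` norms, then convolution by a
function of finite weighted norm is a limit of convolutions by finitely supported functions. -/
theorem exists_mem_closure {w : G → ℝ≥0∞} {C : ℝ≥0∞} (hC : C ≠ ∞)
    (h : ∀ u : G → ℝ≥0∞, ActBound X u (C * l2 fun x => u x * w x)) {ξ : G → ℂ}
    (hξ : l2 (fun x => ‖ξ x‖ₑ * w x) ≠ ∞) :
    ∃ T ∈ closure {T : E →L[ℂ] E | ∃ f : G →₀ ℂ, M.IsConvolution f T}, M.IsConvolution ξ T := by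
  classical
  obtain ⟨T, hT⟩ := M.exists_isConvolution (ENNReal.mul_ne_top hC hξ) (h _)
  refine ⟨T, ?_, hT⟩
  let f : Finset G → G →₀ ℂ := fun F =>
    Finsupp.onFinset F (fun z => if z ∈ F then ξ z else 0) fun z hz => by
      by_contra hc
      simp [hc] at hz
  have hle : ∀ F : Finset G, l2 (fun x => ‖f F x‖ₑ * w x) ≤ l2 fun x => ‖ξ x‖ₑ * w x :=
    fun F => l2_mono fun x => by
      gcongr
      simp only [f, Finsupp.onFinset_apply]
      split_ifs <;> simp
  have hf : ∀ F, l2 (fun x => ‖f F x‖ₑ * w x) ≠ ∞ := fun F => ne_top_of_le_ne_top hξ (hle F)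
  choose U hU using fun F => M.exists_isConvolution (ENNReal.mul_ne_top hC (hf F)) (h _)
  refine mem_closure_of_tendsto (b := atTop) (f := U) ?_
    (Eventually.of_forall fun F => ⟨f F, hU F⟩)
  -- The error operator is convolution by `ξ` off `F`, so its norm is at most `C` times a weighted
  -- `ℓ²` tail.
  let b : Finset G → ℝ≥0∞ := fun F => C * (∑' x : {x // x ∉ F}, (‖ξ x‖ₑ * w x) ^ 2) ^ (1 / 2 : ℝ)
  have hl2 : ∀ F : Finset G, l2 (fun x => ‖ξ x - f F x‖ₑ * w x) =
      (∑' x : {x // x ∉ F}, (‖ξ x‖ₑ * w x) ^ 2) ^ (1 / 2 : ℝ) := fun F => by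
    rw [l2]
    congr 1
    refine Eq.trans ?_ (tsum_subtype {x | x ∉ F} fun x => (‖ξ x‖ₑ * w x) ^ 2).symm
    refine tsum_congr fun x => ?_
    by_cases hx : x ∈ F <;> simp [f, hx]
  have hb0 : Tendsto b atTop (𝓝 0) := by
    have h1 : ∑' x, (‖ξ x‖ₑ * w x) ^ 2 ≠ ∞ := by
      rw [← l2_sq]
      simp [hξ]
    have h2 := ENNReal.tendsto_tsum_compl_atTop_zero h1
    have h3 := (ENNReal.continuous_rpow_const (y := (1 / 2 : ℝ))).tendsto 0 |>.comp h2
    rw [ENNReal.zero_rpow_of_pos (by norm_num)] at h3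
    have h4 := ENNReal.Tendsto.const_mul (a := C) h3 (Or.inr hC)
    rw [mul_zero] at h4
    exact h4
  have hbt : ∀ F, b F ≠ ∞ := fun F => by
    refine ENNReal.mul_ne_top hC ?_
    rw [← hl2]
    refine ne_top_of_le_ne_top hξ (l2_mono fun x => ?_)
    gcongr
    simp only [f, Finsupp.onFinset_apply]
    split_ifs <;> simp
  have hnorm : ∀ F, ‖U F - T‖ ≤ (b F).toReal := fun F => by
    rw [norm_sub_rev]
    refine M.enorm_le_of_isConvolution (hbt F) ?_ (M.isConvolution_sub
      (ENNReal.mul_ne_top hC hξ) (ENNReal.mul_ne_top hC (hf F)) (h _) (h _) hT (hU F))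
    simp only [b, ← hl2]
    exact h _
  refine tendsto_iff_norm_sub_tendsto_zero.2 (squeeze_zero (fun F => norm_nonneg _) hnorm ?_)
  exact (ENNReal.tendsto_toReal ENNReal.zero_ne_top).comp hb0

/-- A nonnegative function convolving by a bounded operator has a finite convolution norm. -/
theorem exists_actBound {u : G → ℝ≥0∞} (hu : l2 u ≠ ∞) {T : E →L[ℂ] E}
    (hT : M.IsConvolution (fun z => (((u z).toReal : ℝ) : ℂ)) T) :
    ∃ K : ℝ≥0∞, K ≠ ∞ ∧ ActBound X u K := by
  -- Adding `1` keeps the constant nonzero, so the bound is trivial when `V` has infinite norm.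
  refine ⟨‖T‖ₑ + 1, by simp, fun V => ?_⟩
  obtain ⟨v, rfl⟩ := M.push_surjective V
  by_cases hv : l2 (M.push v) = ∞
  · simp [hv]
  have hvl : l2 v ≠ ∞ := ne_top_of_le_ne_top hv (M.l2_le v)
  have hvt : ∀ x, v x ≠ ∞ := fun x => ne_top_of_le_ne_top hvl (le_l2 v x)
  have hvn : (fun x => ‖(((v x).toReal : ℝ) : ℂ)‖ₑ) = v :=
    funext fun x => enorm_ofReal_toReal (hvt x)
  obtain ⟨φ, hφ⟩ := M.exists_toFun_eq (fun x => (((v x).toReal : ℝ) : ℂ)) (by rwa [hvn])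
  have h1 : ‖T φ‖ₑ = l2 (actConv u (M.push v)) := by
    rw [M.enorm_eq, hT, hφ, ← M.push_actConv]
    congr 2
    funext x
    exact enorm_convolution_toReal
      (ne_top_of_le_ne_top (ENNReal.mul_ne_top hu hvl) (actConv_le_l2 u v x))
  have h2 : ‖φ‖ₑ = l2 (M.push v) := by rw [M.enorm_eq, hφ, hvn]
  rw [← h1, ← h2]
  exact (T.le_opENorm φ).trans (by gcongr; exact le_self_add)

end ConvolutionModel

section models

theorem memℓp_iff_tsum_enorm_ne_top {α : Type*} {E : α → Type*} [∀ i, NormedAddCommGroup (E i)]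
    {p : ℝ≥0∞} {n : ℕ} (hp : p.toReal = n) (hn : 0 < n) {f : ∀ i, E i} :
    Memℓp f p ↔ ∑' i, ‖f i‖ₑ ^ n ≠ ∞ := by
  rw [memℓp_gen_iff (by rw [hp]; exact_mod_cast hn), hp]
  simp_rw [Real.rpow_natCast]
  constructor
  · intro h
    convert h.tsum_ofReal_ne_top using 4 with i
    rw [← ofReal_norm, ENNReal.ofReal_pow (norm_nonneg _)]
  · intro h
    simpa using ENNReal.summable_toReal h

theorem enorm_lp_pow {α : Type*} {E : α → Type*} [∀ i, NormedAddCommGroup (E i)]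
    {p : ℝ≥0∞} [Fact (1 ≤ p)] {n : ℕ} (hp : p.toReal = n) (hn : 0 < n) (f : lp E p) :
    ‖f‖ₑ ^ n = ∑' i, ‖f i‖ₑ ^ n := by
  have h := lp.hasSum_norm (by rw [hp]; exact_mod_cast hn) f
  rw [hp] at h
  simp_rw [Real.rpow_natCast] at h
  rw [← ofReal_norm, ← ENNReal.ofReal_pow (norm_nonneg _), ← h.tsum_eq,
    ENNReal.ofReal_tsum_of_nonneg (fun i => by positivity) h.summable]
  simp_rw [← ofReal_norm, ENNReal.ofReal_pow (norm_nonneg _)]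

theorem enorm_lp_two {α : Type*} {E : α → Type*} [∀ i, NormedAddCommGroup (E i)] (f : lp E 2) :
    ‖f‖ₑ = l2 fun i => ‖f i‖ₑ := by
  rw [l2, ← enorm_lp_pow (n := 2) (by simp) two_pos, sq_sqrt]

theorem memℓp_two_iff {α : Type*} {E : α → Type*} [∀ i, NormedAddCommGroup (E i)]
    {f : ∀ i, E i} : Memℓp f 2 ↔ l2 (fun i => ‖f i‖ₑ) ≠ ∞ := by
  rw [memℓp_iff_tsum_enorm_ne_top (n := 2) (by simp) two_pos, ← l2_sq]
  simp

variable (G : Type*) [Group G]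

/-- The regular representation. -/
def ellTwoModel : ConvolutionModel G G (EllTwo G) where
  toFun :=
    { toFun := fun φ => φ
      map_add' := fun _ _ => rfl
      map_smul' := fun _ _ => rfl }
  push u := u
  enorm_eq φ := enorm_lp_two φ
  exists_toFun_eq f hf := ⟨⟨f, memℓp_two_iff.2 hf⟩, rfl⟩
  push_mono _ _ h := h
  push_actConv _ _ := rfl
  push_surjective v := ⟨v, rfl⟩
  l2_le _ := le_rfl

variable {G}

theorem enorm_hybridLp_apply {H : Subgroup G} (φ : HybridLp H) (q : G ⧸ H) :
    ‖φ q‖ₑ = cosetSum H (fun x => ‖hybridFun φ x‖ₑ) q := by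
  have h := enorm_lp_pow (n := 1) (by simp) one_pos (φ q)
  simp only [pow_one] at h
  rw [h]
  refine tsum_congr ?_
  rintro ⟨x, rfl⟩
  rfl

/-- The action on the hybrid space `ℓ^(2,1)(G, H)`. -/
def hybridModel (H : Subgroup G) : ConvolutionModel G (G ⧸ H) (HybridLp H) where
  toFun :=
    { toFun := hybridFun
      map_add' := fun _ _ => rfl
      map_smul' := fun _ _ => rfl }
  push := cosetSum H
  enorm_eq φ := by
    rw [enorm_lp_two]
    simp_rw [enorm_hybridLp_apply]
    rfl
  exists_toFun_eq f hf := by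
    have h1 (q : G ⧸ H) : Memℓp (fun x : {x : G // (x : G ⧸ H) = q} => f x) 1 := by
      rw [memℓp_iff_tsum_enorm_ne_top (n := 1) (by simp) one_pos]
      simp only [pow_one]
      exact ne_top_of_le_ne_top hf (le_l2 (cosetSum H fun x => ‖f x‖ₑ) q)
    let g (q : G ⧸ H) : lp (fun _ : {x : G // (x : G ⧸ H) = q} => ℂ) 1 := ⟨_, h1 q⟩
    have h2 : Memℓp g 2 := by
      refine memℓp_two_iff.2 (ne_of_eq_of_ne ?_ hf)
      congr 1
      funext q
      have h := enorm_lp_pow (n := 1) (by simp) one_pos (g q)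
      simp only [pow_one] at h
      exact h
    exact ⟨⟨g, h2⟩, rfl⟩
  push_mono _ _ h := cosetSum_mono H h
  push_actConv u v := cosetSum_actConv H u v
  push_surjective := cosetSum_surjective H
  l2_le u := l2_le_l2_cosetSum H u

end models

/-! ### Word length as a symmetric subadditive length. -/

section wordLength

variable {G : Type*} [Group G] {S : Finset G}

/-- Generation makes the set of word lengths nonempty, so the infimum is attained and is not the
default value `0`. -/
theorem exists_word_length_eq (hS : Subgroup.closure (S : Set G) = ⊤) (x : G) :
    ∃ l : List G, l.length = wordLength S x ∧ (∀ s ∈ l, s ∈ S ∨ s⁻¹ ∈ S) ∧ l.prod = x := by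
  have hx : x ∈ (Subgroup.closure (S : Set G)).toSubmonoid := by simp [hS]
  rw [Subgroup.closure_toSubmonoid] at hx
  obtain ⟨l, hl, hprod⟩ := Submonoid.exists_list_of_mem_closure hx
  exact Nat.sInf_mem (s := {n : ℕ | ∃ l : List G, l.length = n ∧
    (∀ s ∈ l, s ∈ S ∨ s⁻¹ ∈ S) ∧ l.prod = x}) ⟨l.length, l, rfl, hl, hprod⟩

theorem wordLength_prod_le (l : List G) (hl : ∀ s ∈ l, s ∈ S ∨ s⁻¹ ∈ S) :
    wordLength S l.prod ≤ l.length :=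
  Nat.sInf_le ⟨l, rfl, hl, rfl⟩

theorem wordLength_mul_le (hS : Subgroup.closure (S : Set G) = ⊤) (x y : G) :
    wordLength S (x * y) ≤ wordLength S x + wordLength S y := by
  obtain ⟨l, hl, hls, rfl⟩ := exists_word_length_eq hS x
  obtain ⟨m, hm, hms, rfl⟩ := exists_word_length_eq hS y
  rw [← hl, ← hm, ← List.prod_append, ← List.length_append]
  refine wordLength_prod_le _ fun s hs => ?_
  rcases List.mem_append.1 hs with h | h
  exacts [hls s h, hms s h]

theorem wordLength_inv_le (hS : Subgroup.closure (S : Set G) = ⊤) (x : G) :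
    wordLength S x⁻¹ ≤ wordLength S x := by
  obtain ⟨l, hl, hls, hx⟩ := exists_word_length_eq hS x
  rw [← hl, ← hx, List.prod_inv_reverse]
  refine (wordLength_prod_le _ fun s hs => ?_).trans (by simp)
  obtain ⟨t, ht, rfl⟩ := List.mem_map.1 (List.mem_reverse.1 hs)
  rw [inv_inv]
  exact (hls t ht).symm

theorem wordLength_inv (hS : Subgroup.closure (S : Set G) = ⊤) (x : G) :
    wordLength S x⁻¹ = wordLength S x :=
  le_antisymm (wordLength_inv_le hS x) (by simpa using wordLength_inv_le hS x⁻¹)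

end wordLength

section growth

variable {G : Type*} [Group G] {ℓ : G → ℕ} {H : Subgroup G}

theorem Polynomial.eval_natCast_le (Q : Polynomial ℝ) (n : ℕ) :
    Q.eval (n : ℝ) ≤ (∑ i ∈ Finset.range (Q.natDegree + 1), |Q.coeff i|) *
      (1 + n) ^ Q.natDegree := by
  rw [Polynomial.eval_eq_sum_range, Finset.sum_mul]
  refine Finset.sum_le_sum fun i hi => ?_
  have hi' : i ≤ Q.natDegree := Nat.lt_succ_iff.1 (Finset.mem_range.1 hi)
  gcongr
  · exact le_abs_self _
  · exact (pow_le_pow_left₀ (by positivity) (by linarith) i).trans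
      (pow_le_pow_right₀ (by linarith [n.cast_nonneg (α := ℝ)]) hi')

theorem PolynomialGrowth.exists_ballCount_le (h : PolynomialGrowth ℓ H) :
    ∃ C : ℝ≥0∞, C ≠ ∞ ∧ ∃ d : ℕ, ∀ n : ℕ, ballCount ℓ (H : Set G) n ≤ C * (1 + n) ^ d := by
  classical
  obtain ⟨Q, hQ⟩ := h
  refine ⟨ENNReal.ofReal (∑ i ∈ Finset.range (Q.natDegree + 1), |Q.coeff i|),
    ENNReal.ofReal_ne_top, Q.natDegree, fun n => ?_⟩
  obtain ⟨hfin, hcard⟩ := hQ n n.cast_nonneg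
  have h1 : ballCount ℓ (H : Set G) n =
      (({h : G | h ∈ H ∧ (ℓ h : ℝ) ≤ n}.ncard : ℕ) : ℝ≥0∞) := by
    rw [ballCount, tsum_subtype (H : Set G) fun x => if ℓ x ≤ n then (1 : ℝ≥0∞) else 0,
      tsum_eq_sum (s := hfin.toFinset), Set.ncard_eq_toFinset_card _ hfin]
    · rw [Finset.sum_congr rfl (g := fun _ => (1 : ℝ≥0∞)), Finset.sum_const, nsmul_one]
      intro x hx
      simp only [Set.Finite.mem_toFinset, Set.mem_ofPred_eq, Nat.cast_le] at hx
      simp [hx.1, hx.2]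
    · intro x hx
      simp only [Set.Finite.mem_toFinset, Set.mem_ofPred_eq, Nat.cast_le, not_and] at hx
      by_cases hxH : x ∈ H
      · simp [hx hxH]
      · simp [hxH]
  rw [h1, ← ENNReal.ofReal_natCast]
  refine (ENNReal.ofReal_le_ofReal (hcard.trans (Q.eval_natCast_le n))).trans (le_of_eq ?_)
  rw [ENNReal.ofReal_mul (Finset.sum_nonneg fun i _ => abs_nonneg _),
    ENNReal.ofReal_pow (by positivity), ENNReal.ofReal_add zero_le_one n.cast_nonneg]
  simp

theorem polynomialGrowth_bot : PolynomialGrowth ℓ (⊥ : Subgroup G) := by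
  refine ⟨1, fun R _ => ?_⟩
  have hsub : {h : G | h ∈ (⊥ : Subgroup G) ∧ (ℓ h : ℝ) ≤ R} ⊆ {1} := fun h hh =>
    Subgroup.mem_bot.1 hh.1
  refine ⟨(Set.finite_singleton 1).subset hsub, ?_⟩
  have := Set.ncard_le_ncard hsub
  rw [Set.ncard_singleton] at this
  simpa using (by exact_mod_cast this :
    (({h : G | h ∈ (⊥ : Subgroup G) ∧ (ℓ h : ℝ) ≤ R}.ncard : ℕ) : ℝ) ≤ 1)

end growth

section weight

variable {G : Type*} {ℓ : G → ℕ}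

theorem enorm_rpow_length (s : ℝ) (x : G) :
    ‖(((1 + (ℓ x : ℝ)) ^ s : ℝ) : ℂ)‖ₑ = ENNReal.ofReal ((1 + (ℓ x : ℝ)) ^ s) := by
  rw [← ofReal_norm, Complex.norm_real, Real.norm_of_nonneg (by positivity)]

theorem lengthWeight_eq_ofReal (k : ℕ) (x : G) :
    lengthWeight ℓ k x = ENNReal.ofReal ((1 + (ℓ x : ℝ)) ^ (k : ℝ)) := by
  rw [Real.rpow_natCast, ENNReal.ofReal_pow (by positivity),
    ENNReal.ofReal_add zero_le_one (Nat.cast_nonneg _)]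
  simp [lengthWeight]

theorem enorm_rpow_length_le {s : ℝ} {k : ℕ} (h : s ≤ k) (x : G) :
    ‖(((1 + (ℓ x : ℝ)) ^ s : ℝ) : ℂ)‖ₑ ≤ lengthWeight ℓ k x := by
  rw [enorm_rpow_length, lengthWeight_eq_ofReal]
  exact ENNReal.ofReal_le_ofReal (Real.rpow_le_rpow_of_exponent_le (by simp) h)

theorem lengthWeight_le_enorm_rpow {s : ℝ} {k : ℕ} (h : (k : ℝ) ≤ s) (x : G) :
    lengthWeight ℓ k x ≤ ‖(((1 + (ℓ x : ℝ)) ^ s : ℝ) : ℂ)‖ₑ := by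
  rw [enorm_rpow_length, lengthWeight_eq_ofReal]
  exact ENNReal.ofReal_le_ofReal (Real.rpow_le_rpow_of_exponent_le (by simp) h)

theorem l2_weight_tsum_le (k : ℕ) (a : ℕ → G → ℝ≥0∞) :
    l2 (fun x => (∑' j, a j x) * lengthWeight ℓ k x) ≤
      ∑' j, l2 fun x => a j x * lengthWeight ℓ k x := by
  simp_rw [← ENNReal.tsum_mul_right]
  exact l2_tsum_le _

end weight

/-! ### From pointwise finiteness to uniform bounds. -/

section uniform

variable {G X : Type*} [Group G] [MulAction G X]

/-- A gliding hump argument: if all functions on which an increasing sequence of norms is finite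
have a finite convolution norm, then the convolution norm is controlled by one of these norms. -/
theorem exists_uniform_actBound (p : ℕ → (G → ℝ≥0∞) → ℝ≥0∞)
    (hmono : ∀ j k u, j ≤ k → p j u ≤ p k u)
    (htsum : ∀ k (a : ℕ → G → ℝ≥0∞), p k (fun x => ∑' j, a j x) ≤ ∑' j, p k (a j))
    (hmul : ∀ k c u, p k (fun x => c * u x) = c * p k u)
    (hfin : ∀ k u (F : Finset G), (∀ x, u x ≠ ∞) → (∀ x ∉ F, u x = 0) → p k u ≠ ∞)
    (hzero : ∀ k u, p k u = 0 → ∀ x, u x = 0)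
    (h : ∀ u, (∀ k, p k u ≠ ∞) → ∃ K : ℝ≥0∞, K ≠ ∞ ∧ ActBound X u K) :
    ∃ k, ∃ C : ℝ≥0∞, C ≠ ∞ ∧ ∀ (u : G → ℝ≥0∞) (F : Finset G), (∀ x, u x ≠ ∞) →
      (∀ x ∉ F, u x = 0) → ActBound X u (C * p k u) := by
  by_contra! hcon
  -- One factor `2 ^ k` normalizes the hump `a k` to have `p k`-norm `2⁻¹ ^ k`; the other leaves it
  -- with no convolution bound `2 ^ k`.
  choose u F hut hF hu using fun k : ℕ => hcon k (2 ^ k * 2 ^ k) (by simp [ENNReal.mul_eq_top])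
  have hpt : ∀ j k, p j (u k) ≠ ∞ := fun j k => hfin j (u k) (F k) (hut k) (hF k)
  have hp0 : ∀ k, p k (u k) ≠ 0 := fun k h0 => by
    have h1 : u k = fun _ => 0 := funext (hzero k _ h0)
    exact hu k (by rw [h1]; exact actBound_zero.mono (fun _ => le_rfl) zero_le)
  have h20 (k : ℕ) : (2 ^ k : ℝ≥0∞) ≠ 0 := by simp
  have h2t (k : ℕ) : (2 ^ k : ℝ≥0∞) ≠ ∞ := by simp
  let e (k : ℕ) : ℝ≥0∞ := 2 ^ k * p k (u k)
  have he0 : ∀ k, e k ≠ 0 := fun k => mul_ne_zero (h20 k) (hp0 k)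
  have het : ∀ k, e k ≠ ∞ := fun k => ENNReal.mul_ne_top (h2t k) (hpt k k)
  let a (k : ℕ) : G → ℝ≥0∞ := fun x => (e k)⁻¹ * u k x
  have hpa : ∀ k, p k (a k) = (2⁻¹ : ℝ≥0∞) ^ k := fun k => by
    simp only [a, e, hmul]
    rw [ENNReal.mul_inv (Or.inl (h20 k)) (Or.inl (h2t k)), mul_assoc,
      ENNReal.inv_mul_cancel (hp0 k) (hpt k k), mul_one, ENNReal.inv_pow]
  have hpat : ∀ j k, p j (a k) ≠ ∞ := fun j k => by
    simp only [a, hmul]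
    exact ENNReal.mul_ne_top (ENNReal.inv_ne_top.2 (he0 k)) (hpt j k)
  obtain ⟨K, hKt, hK⟩ := h (fun x => ∑' k, a k x) fun j => by
    refine ne_top_of_le_ne_top ?_ (htsum j a)
    -- Finitely many humps have index below `j`; for the others `p j ≤ p k` gives a geometric bound.
    have hle : ∀ k, p j (a k) ≤ (if k ∈ Finset.range j then p j (a k) else 0) +
        (2⁻¹ : ℝ≥0∞) ^ k := fun k => by
      split_ifs with hk
      · exact le_self_add
      · rw [zero_add, ← hpa]
        exact hmono _ _ _ (by simpa using hk)
    refine ne_top_of_le_ne_top ?_ (ENNReal.tsum_le_tsum hle)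
    rw [ENNReal.tsum_add, tsum_eq_sum (s := Finset.range j) (fun k hk => by simp [hk])]
    refine ENNReal.add_ne_top.2 ⟨?_, ?_⟩
    · refine (ENNReal.sum_lt_top.2 fun k _ => ?_).ne
      split_ifs
      exact (hpat j k).lt_top
    · rw [ENNReal.tsum_geometric]
      simp
  obtain ⟨k, hk⟩ := ENNReal.exists_nat_gt hKt
  have hk2 : K ≤ 2 ^ k := hk.le.trans (by exact_mod_cast Nat.lt_two_pow_self.le)
  refine hu k ?_
  -- Each hump lies below the sum, and convolution bounds are monotone on nonnegative functions.
  have h1 : ActBound X (a k) (2 ^ k) :=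
    hK.mono (fun x => ENNReal.le_tsum (f := fun k => a k x) k) hk2
  have h2 := h1.const_mul (e k)
  have h3 : (fun x => e k * a k x) = u k := funext fun x => by
    simp only [a]
    rw [← mul_assoc, ENNReal.mul_inv_cancel (he0 k) (het k), one_mul]
  rw [h3] at h2
  refine h2.mono (fun _ => le_rfl) (le_of_eq ?_)
  simp only [e]
  ring

variable {ℓ : G → ℕ}

theorem l2_cosetSum_weight_tsum_le (H : Subgroup G) (k : ℕ) (a : ℕ → G → ℝ≥0∞) :
    l2 (cosetSum H fun x => (∑' j, a j x) * lengthWeight ℓ k x) ≤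
      ∑' j, l2 (cosetSum H fun x => a j x * lengthWeight ℓ k x) := by
  refine le_trans (le_of_eq ?_) (l2_tsum_le _)
  congr 1
  funext q
  simp_rw [cosetSum, ← ENNReal.tsum_mul_right]
  exact ENNReal.tsum_comm

theorem cosetSum_const_mul (H : Subgroup G) (c : ℝ≥0∞) (u : G → ℝ≥0∞) :
    cosetSum H (fun x => c * u x) = fun q => c * cosetSum H u q :=
  funext fun _ => ENNReal.tsum_mul_left

theorem l2_cosetSum_ne_top (H : Subgroup G) {u : G → ℝ≥0∞} (F : Finset G) (hu : ∀ x, u x ≠ ∞)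
    (hF : ∀ x ∉ F, u x = 0) : l2 (cosetSum H u) ≠ ∞ := by
  classical
  refine l2_ne_top_of_finite_support (F.image (QuotientGroup.mk (s := H))) (fun q hq => ?_) fun q => ?_
  · refine ENNReal.tsum_eq_zero.2 ?_
    rintro ⟨x, rfl⟩
    exact hF x fun hx => hq (Finset.mem_image_of_mem _ hx)
  · refine ne_top_of_le_ne_top (b := ∑' x, u x) ?_ ?_
    · rw [tsum_eq_sum hF]
      exact (ENNReal.sum_lt_top.2 fun x _ => (hu x).lt_top).ne
    · exact ENNReal.tsum_comp_le_tsum_of_injective Subtype.val_injective u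

/-- Weighted bounds for finitely supported functions extend to all functions. -/
theorem actBound_of_finite_support {k : ℕ} {C : ℝ≥0∞}
    (h : ∀ (u : G → ℝ≥0∞) (F : Finset G), (∀ x, u x ≠ ∞) → (∀ x ∉ F, u x = 0) →
      ActBound X u (C * l2 fun x => u x * lengthWeight ℓ k x)) (u : G → ℝ≥0∞) :
    ActBound X u ((C + 1) * l2 fun x => u x * lengthWeight ℓ k x) := by
  by_cases htop : l2 (fun x => u x * lengthWeight ℓ k x) = ∞
  · rw [htop, ENNReal.mul_top (by simp)]
    exact actBound_top u
  · refine ActBound.of_truncations fun F => ?_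
    have hu : ∀ x, u x ≠ ∞ := fun x => ne_top_of_le_ne_top htop
      (le_trans (le_mul_of_one_le_right' (one_le_lengthWeight k x))
        (le_l2 (fun x => u x * lengthWeight ℓ k x) x))
    have hle : ∀ x, Set.indicator (F : Set G) u x ≤ u x := Set.indicator_le_self _ _
    refine (h _ F (fun x => ne_top_of_le_ne_top (hu x) (hle x)) fun x hx => by simp [hx]).mono
      (fun _ => le_rfl) ?_
    gcongr
    · exact le_self_add
    · exact l2_mono fun x => by gcongr; exact hle x

end uniform

/-! ### Rapid decay as weighted convolution bounds, and the implications. -/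

section rapidDecay

variable {G : Type*} [Group G] {ℓ : G → ℕ}

theorem RapidDecay.exists_actBound (h : RapidDecay ℓ) :
    ∃ k, ∃ C : ℝ≥0∞, C ≠ ∞ ∧ ∀ (u : G → ℝ≥0∞) (F : Finset G), (∀ x, u x ≠ ∞) →
      (∀ x ∉ F, u x = 0) → ActBound G u (C * l2 fun x => u x * lengthWeight ℓ k x) := by
  refine exists_uniform_actBound (fun k u => l2 fun x => u x * lengthWeight ℓ k x)
    (fun j k u hjk => l2_mono fun x => by gcongr; exact lengthWeight_mono hjk x)
    l2_weight_tsum_le (fun k c u => ?_) (fun k u F hu hF => ?_) (fun k u h0 x => ?_)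
    fun u hu => ?_
  · simp_rw [mul_assoc, l2_const_mul]
  · exact l2_ne_top_of_finite_support F (fun x hx => by simp [hF x hx]) fun x =>
      ENNReal.mul_ne_top (hu x) (lengthWeight_ne_top k x)
  · simpa [lengthWeight_ne_zero] using l2_eq_zero.1 h0 x
  · have hu2 : l2 u ≠ ∞ := by simpa [lengthWeight] using hu 0
    have hn : ∀ x, ‖(((u x).toReal : ℝ) : ℂ)‖ₑ = u x := fun x =>
      enorm_ofReal_toReal (ne_top_of_le_ne_top hu2 (le_l2 u x))
    obtain ⟨T, -, hT⟩ := h (fun x => (((u x).toReal : ℝ) : ℂ)) fun s _ => by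
      obtain ⟨k, hk⟩ := exists_nat_ge s
      refine ⟨memℓp_two_iff.2 (by simpa only [hn] using hu2), memℓp_two_iff.2 ?_⟩
      refine ne_top_of_le_ne_top (hu k) (l2_mono fun x => ?_)
      rw [enorm_mul, hn]
      gcongr
      exact enorm_rpow_length_le hk x
    exact (ellTwoModel G).exists_actBound hu2 hT

theorem rapidDecay_of_actBound {k : ℕ} {C : ℝ≥0∞} (hC : C ≠ ∞)
    (h : ∀ u : G → ℝ≥0∞, ActBound G u (C * l2 fun x => u x * lengthWeight ℓ k x)) :
    RapidDecay ℓ := fun ξ hξ => by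
  refine (ellTwoModel G).exists_mem_closure hC h ?_
  refine ne_top_of_le_ne_top (memℓp_two_iff.1 (hξ k k.cast_nonneg).2) (l2_mono fun x => ?_)
  rw [enorm_mul]
  gcongr
  exact lengthWeight_le_enorm_rpow le_rfl x

variable {H : Subgroup G}

theorem PairRapidDecay.exists_actBound (h : PairRapidDecay ℓ H) :
    ∃ k, ∃ C : ℝ≥0∞, C ≠ ∞ ∧ ∀ (u : G → ℝ≥0∞) (F : Finset G), (∀ x, u x ≠ ∞) →
      (∀ x ∉ F, u x = 0) →
        ActBound (G ⧸ H) u (C * l2 (cosetSum H fun x => u x * lengthWeight ℓ k x)) := by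
  obtain ⟨s, -, hs⟩ := h
  obtain ⟨n, hn⟩ := exists_nat_ge s
  -- Pair rapid decay fixes one exponent, so the gliding hump runs with a constant sequence of norms
  -- and its index is discarded.
  refine ⟨n, (exists_const ℕ).1 ?_⟩
  refine exists_uniform_actBound (X := G ⧸ H)
    (fun _ u => l2 (cosetSum H fun x => u x * lengthWeight ℓ n x))
    (fun j k u hjk => le_rfl) (fun _ => l2_cosetSum_weight_tsum_le H n) (fun k c u => ?_)
    (fun k u F hu hF => ?_) (fun k u h0 x => ?_) fun u hu => ?_
  · simp_rw [mul_assoc, cosetSum_const_mul, l2_const_mul]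
  · exact l2_cosetSum_ne_top H F
      (fun x => ENNReal.mul_ne_top (hu x) (lengthWeight_ne_top n x))
      fun x hx => by simp [hF x hx]
  · have h1 := l2_eq_zero.1 (le_antisymm ((l2_le_l2_cosetSum H _).trans h0.le) zero_le) x
    simpa [lengthWeight_ne_zero] using h1
  · have hu1 : l2 (fun x => u x * lengthWeight ℓ n x) ≠ ∞ :=
      ne_top_of_le_ne_top (hu 0) (l2_le_l2_cosetSum H _)
    have hu2 : l2 u ≠ ∞ := ne_top_of_le_ne_top hu1
      (l2_mono fun x => le_mul_of_one_le_right' (one_le_lengthWeight n x))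
    have hn' : ∀ x, ‖(((u x).toReal : ℝ) : ℂ)‖ₑ = u x := fun x =>
      enorm_ofReal_toReal (ne_top_of_le_ne_top hu2 (le_l2 u x))
    obtain ⟨T, -, hT⟩ := hs (fun x => (((u x).toReal : ℝ) : ℂ)) (by
      refine ⟨memℓp_two_iff.2 (by simpa only [hn'] using hu2), ?_⟩
      refine (hybridModel H).exists_toFun_eq _ ?_
      refine ne_top_of_le_ne_top (hu 0) (l2_mono
        ((hybridModel H).push_mono _ (fun x => u x * lengthWeight ℓ n x) fun x => ?_))
      rw [enorm_mul, hn']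
      gcongr
      exact enorm_rpow_length_le hn x)
    exact (hybridModel H).exists_actBound hu2 hT

theorem pairRapidDecay_of_actBound {k : ℕ} {C : ℝ≥0∞} (hC : C ≠ ∞)
    (h : ∀ u : G → ℝ≥0∞, ActBound (G ⧸ H) u (C * l2 fun x => u x * lengthWeight ℓ k x)) :
    PairRapidDecay ℓ H := by
  -- The exponent must be positive, and `k` may be `0`.
  refine ⟨k + 1, by positivity, ?_⟩
  rintro ξ ⟨-, η, hη⟩
  refine (hybridModel H).exists_mem_closure hC h ?_
  have h1 : l2 (fun x => ‖hybridFun η x‖ₑ) ≠ ∞ :=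
    ne_top_of_le_ne_top (((hybridModel H).enorm_eq η).symm ▸ enorm_ne_top)
      (l2_le_l2_cosetSum H _)
  refine ne_top_of_le_ne_top h1 (l2_mono fun x => ?_)
  rw [hη, enorm_mul]
  gcongr
  exact lengthWeight_le_enorm_rpow (by simp) x

theorem RapidDecay.pairRapidDecay (hmul : ∀ x y, ℓ (x * y) ≤ ℓ x + ℓ y)
    (hinv : ∀ x, ℓ x⁻¹ = ℓ x) (h : RapidDecay ℓ) (hH : PolynomialGrowth ℓ H) :
    PairRapidDecay ℓ H := by
  obtain ⟨C, hC, d, hg⟩ := hH.exists_ballCount_le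
  obtain ⟨k, D, hD, hb⟩ := h.exists_actBound
  refine pairRapidDecay_of_actBound (k := k) (C := D + 1) (by simp [hD])
    (actBound_of_finite_support fun u F hu hF => ?_)
  refine ActBound.to_quotient hmul hinv hC hg F hF (ENNReal.mul_ne_top hD ?_) (hb u F hu hF)
  exact l2_ne_top_of_finite_support F (fun x hx => by simp [hF x hx]) fun x =>
    ENNReal.mul_ne_top (hu x) (lengthWeight_ne_top k x)

theorem PairRapidDecay.rapidDecay (hmul : ∀ x y, ℓ (x * y) ≤ ℓ x + ℓ y)
    (hinv : ∀ x, ℓ x⁻¹ = ℓ x) (h : PairRapidDecay ℓ H) (hH : PolynomialGrowth ℓ H) :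
    RapidDecay ℓ := by
  obtain ⟨C, hC, d, hg⟩ := hH.exists_ballCount_le
  obtain ⟨k, D, hD, hb⟩ := h.exists_actBound
  obtain ⟨B, hB, hBb⟩ := l2_cosetSum_lengthWeight_le hmul hinv hC hg k
  refine rapidDecay_of_actBound (k := k + (d + 2)) (C := D * B + 1)
    (ENNReal.add_ne_top.2 ⟨ENNReal.mul_ne_top hD hB, ENNReal.one_ne_top⟩)
    (actBound_of_finite_support fun u F hu hF => ?_)
  refine (hb u F hu hF).of_quotient.mono (fun _ => le_rfl) ?_
  rw [mul_assoc]
  gcongr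
  exact hBb u

end rapidDecay

end

theorem mainTheorem6 {G : Type*} [Group G] (S : Finset G)
    (hS : Subgroup.closure (S : Set G) = ⊤) :
    List.TFAE [
      RapidDecay (wordLength S),
      ∀ H : Subgroup G, PolynomialGrowth (wordLength S) H → PairRapidDecay (wordLength S) H,
      ∃ H : Subgroup G, PolynomialGrowth (wordLength S) H ∧ PairRapidDecay (wordLength S) H] := by
  tfae_have 1 → 2 := fun h H hH =>
    h.pairRapidDecay (wordLength_mul_le hS) (wordLength_inv hS) hH
  tfae_have 2 → 3 := fun h => ⟨⊥, polynomialGrowth_bot, h ⊥ polynomialGrowth_bot⟩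
  tfae_have 3 → 1 := fun ⟨H, hH, h⟩ =>
    h.rapidDecay (wordLength_mul_le hS) (wordLength_inv hS) hH
  tfae_finish
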